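/- Let $N\ge 3$ be an integer, $2^*:=\frac{2N}{N-2}$, and let $0<\alpha<2N-2$, $\alpha\ne 2$, and $2<p_1<2^*<p_2$. Let $f:\mathbb R\to\mathbb R$ be continuous and set $F(s):=\int_0^s f(t)\,dt$. Assume that $$\sup_{s>0}\frac{|f(s)|}{\min\{s^{p_1-1},s^{p_2-1}\}}<+\infty,$$ that there is $\theta>2$ with $\theta F(s)\le f(s)s$ for all $s>0$, and that $F(s)>0$ for all $s>0$. Put $2^*_\alpha:=2\,\frac{2N-2+\alpha}{2N-2-\alpha}$. Let $D^{1,2}(\mathbb R^N)=\{u\in L^{2^*}(\mathbb R^N):\nabla u\in L^2(\mathbb R^N)\}$ ($\nabla$ the weak gradient), let $$H^1_\alpha:=\Big\{u\in D^{1,2}(\mathbb R^N):\int_{\mathbb R^N}\frac{u^2}{|x|^\alpha}\,dx<\infty\Big\},$$ and let $H_r$ be the subspace of the radial functions in $H^1_\alpha$, i.e. those $u$ such that $u\circ S=u$ almost everywhere for every linear isometry $S$ of $\mathbb R^N$. For $A>0$ and $u\in H^1_\alpha$ let $$I(u):=\frac12\int_{\mathbb R^N}\Big(|\nabla u|^2+\frac{A}{|x|^\alpha}u^2\Big)dx-\int_{\mathbb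 R^N}F(u)\,dx,$$ where in the last integral $f$ is replaced by $0$ on $(-\infty,0)$, and let $$m_A:=\inf_{u\in H_r\setminus\{0\},\ u\ge0}\ \max_{t\ge0} I(tu).$$ Let $p:=\max\{2^*_\alpha,p_1\}$ if $0<\alpha<2$, and $p:=\min\{2^*_\alpha,p_2\}$ if $2<\alpha<2N-2$. Then there exists a constant $C_0>0$, independent of $A$, such that for every $A>0$ $$m_A\ \ge\ C_0\,A^{\frac{N-2}{\alpha-2}\,\frac{p-2^*}{p-2}}.$$ -/

import Mathlib

open MeasureTheory
open scoped ContDiff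

noncomputable section

namespace RadialNehari

/-- Euclidean `N`-space. -/
abbrev E (N : ℕ) : Type := EuclideanSpace ℝ (Fin N)

/-- The critical Sobolev exponent `2^* = 2N / (N - 2)`. -/
def twoStar (N : ℕ) : ℝ := 2 * (N : ℝ) / ((N : ℝ) - 2)

/-- The exponent `2^*_α = 2 (2N - 2 + α) / (2N - 2 - α)`. -/
def twoStarAlpha (N : ℕ) (α : ℝ) : ℝ :=
  2 * ((2 * (N : ℝ) - 2 + α) / (2 * (N : ℝ) - 2 - α))

/-- `g` is a weak (distributional) gradient of `u` on `ℝ^N`: both are locally integrable and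
`∫ u ∂_i φ = - ∫ g_i φ` for all `φ ∈ C_c^∞(ℝ^N)` and all `i`. -/
def IsWeakGradient {N : ℕ} (u : E N → ℝ) (g : E N → E N) : Prop :=
  LocallyIntegrable u volume ∧ LocallyIntegrable g volume ∧
    ∀ φ : E N → ℝ, ContDiff ℝ ∞ φ → HasCompactSupport φ → ∀ i : Fin N,
      ∫ x, u x * fderiv ℝ φ x (EuclideanSpace.single i 1) = - ∫ x, g x i * φ x

/-- Weak gradients are unique up to null sets. -/
theorem IsWeakGradient.ae_eq {N : ℕ} {u : E N → ℝ} {g h : E N → E N}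
    (hg : IsWeakGradient u g) (hh : IsWeakGradient u h) : g =ᵐ[volume] h := by
  have loc : ∀ {k : E N → E N}, LocallyIntegrable k volume → ∀ i : Fin N,
      LocallyIntegrable (fun x => k x i) volume := by
    intro k hk i x
    obtain ⟨s, hs, hi⟩ := hk x
    exact ⟨s, hs, (EuclideanSpace.proj (𝕜 := ℝ) i).integrable_comp hi⟩
  have key : ∀ i : Fin N, ∀ᵐ x ∂(volume : Measure (E N)), g x i = h x i := by
    intro i
    refine ae_eq_of_integral_contDiff_smul_eq (loc hg.2.1 i) (loc hh.2.1 i) ?_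
    intro φ hφ hc
    have h1 := hg.2.2 φ hφ hc i
    have h2 := hh.2.2 φ hφ hc i
    simp only [smul_eq_mul, mul_comm (φ _)]
    linarith
  filter_upwards [ae_all_iff.2 key] with x hx
  ext i
  exact hx i

open Classical in
/-- The weak gradient `∇u`, if there is one (and `0` otherwise). -/
def weakGradient {N : ℕ} (u : E N → ℝ) : E N → E N :=
  if h : ∃ g, IsWeakGradient u g then h.choose else 0

theorem IsWeakGradient.weakGradient_ae_eq {N : ℕ} {u : E N → ℝ} {g : E N → E N}
    (hg : IsWeakGradient u g) : weakGradient u =ᵐ[volume] g := by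
  have h : ∃ g, IsWeakGradient u g := ⟨g, hg⟩
  rw [weakGradient, dif_pos h]
  exact h.choose_spec.ae_eq hg

/-- `u ∈ D^{1,2}(ℝ^N) = {u ∈ L^{2^*}(ℝ^N) : ∇u ∈ L^2(ℝ^N)}`. -/
def MemD12 {N : ℕ} (u : E N → ℝ) : Prop :=
  MemLp u (ENNReal.ofReal (twoStar N)) volume ∧
    ∃ g : E N → E N, IsWeakGradient u g ∧ MemLp g 2 volume

/-- `u ∈ H^1_α = D^{1,2}(ℝ^N) ∩ L^2(ℝ^N, |x|^{-α} dx)`. -/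
def MemH {N : ℕ} (α : ℝ) (u : E N → ℝ) : Prop :=
  MemD12 u ∧ Integrable (fun x => u x ^ 2 / ‖x‖ ^ α) volume

/-- `u` is radial: invariant, up to null sets, under every linear isometry of `ℝ^N`. -/
def IsRadial {N : ℕ} (u : E N → ℝ) : Prop :=
  ∀ S : E N ≃ₗᵢ[ℝ] E N, (fun x => u (S x)) =ᵐ[volume] u

/-- `u ∈ H_r`, the subspace of radial elements of `H^1_α`. -/
def MemHr {N : ℕ} (α : ℝ) (u : E N → ℝ) : Prop := MemH α u ∧ IsRadial u

/-- `‖u‖_A^2 = ∫ (|∇u|^2 + A |x|^{-α} u^2) dx`. -/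
def normSqA {N : ℕ} (α A : ℝ) (u : E N → ℝ) : ℝ :=
  ∫ x, (‖weakGradient u x‖ ^ 2 + A / ‖x‖ ^ α * u x ^ 2)

/-- `F(s) = ∫_0^s f(t) dt`. -/
def primitive (f : ℝ → ℝ) (s : ℝ) : ℝ := ∫ t in (0 : ℝ)..s, f t

/-- The nonlinearity modified to vanish on the negative half-line. -/
def truncate (f : ℝ → ℝ) (s : ℝ) : ℝ := if s < 0 then 0 else f s

/-- The energy functional `I(u) = ‖u‖_A^2 / 2 - ∫ F(u) dx`, where `F` is the primitive of the
modified nonlinearity. -/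
def energy {N : ℕ} (α A : ℝ) (f : ℝ → ℝ) (u : E N → ℝ) : ℝ :=
  1 / 2 * normSqA α A u - ∫ x, primitive (truncate f) (u x)

/-- `m_A = inf_{u ∈ H_r ∖ {0}, u ≥ 0} max_{t ≥ 0} I(tu)`, as a real number. The conventions
`sSup S = 0` for `S` unbounded above and `sInf ∅ = 0` never help a positive lower bound: such a
bound forces the class of `u` to be nonempty and `t ↦ I(tu)` to be bounded above. -/
def nehariLevel (N : ℕ) (α A : ℝ) (f : ℝ → ℝ) : ℝ :=
  sInf ((fun u : E N → ℝ =>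
      sSup ((fun t : ℝ => energy α A f (fun x => t * u x)) '' Set.Ici 0)) ''
    {u : E N → ℝ | MemHr α u ∧ ¬ u =ᵐ[volume] 0 ∧ 0 ≤ᵐ[volume] u})

end RadialNehari

end

open RadialNehari

/-!
Write `‖u‖_A² = ∫ |∇u|² + A |x|^{-α} u²`, `q = 2^*_α` and `a = N - 1 - α / 2 > 0`. The lower bound
follows from an inequality `∫ |u|^p ≤ K A^{-μ} ‖u‖_A^p` on radial functions, where `p` lies between
`2^*` and `q`. Because `p₁ ≤ p ≤ p₂`, the growth condition gives `|F(s)| ≤ M s^p` for `s ≥ 0`, so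
`I(tu) ≥ t² ‖u‖_A² / 2 - M K A^{-μ} t^p ‖u‖_A^p`, and a single choice of `t ‖u‖_A` makes the right
hand side a fixed multiple of `A^{2μ/(p-2)}`.

The inequality is obtained by interpolation (`exists_embedding_between`) between two endpoints
(`exists_embedding`).

* The Sobolev inequality `‖u‖_{2^*} ≤ C ‖∇u‖_2` (`exists_sobolev`), deduced from Mathlib's
  Gagliardo-Nirenberg-Sobolev inequality for `C¹` functions of compact support by cutting off,
  mollifying and passing to the limit with Fatou's lemma.
* The radial bound `|x|^a u(x)² ≤ C ‖∇u‖_2 ‖|x|^{-α/2} u‖_2` (`exists_radial_bound`). For a smooth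
  compactly supported radial function with profile `h` it follows from `a > 0` by integrating
  `(s^a h²)' ≥ 2 s^a h h'` over `(r, ∞)`, passing to polar coordinates and using the
  Cauchy-Schwarz inequality; only the region `|y| > |x|` enters, so the singularity of the weight
  at the origin does not disturb the mollification argument. As `(q - 2) / 2 = α / a`, inserting
  this bound into `|u|^q = (u²)^{α/a} u²` gives
  `∫ |u|^q ≤ C (A^{-1/2} ‖u‖_A²)^{α/a} ∫ |x|^{-α} u²`.

Two further facts make the real-valued `sInf` and `sSup` meaningful: the class of admissible `u`
contains a bump function supported in an annulus (`exists_memHr`), and `t ↦ I(tu)` is bounded above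
(`bddAbove_energy`), since the condition `θ F(s) ≤ f(s) s` yields `F(ts) ≥ t^θ F(s)` for `t ≥ 1`
with `θ > 2`.
-/

namespace RadialNehari

open Filter Topology Set
open scoped ENNReal NNReal Convolution

variable {N : ℕ}

/-! ### Radial mollifiers -/

/-- A smooth nonnegative kernel of total mass one, depending only on `‖x‖` and vanishing for
`‖x‖ > ε`. -/
structure IsRadialMollifier (φ : E N → ℝ) (ε : ℝ) : Prop where
  contDiff : ContDiff ℝ ∞ φ
  nonneg : ∀ x, 0 ≤ φ x
  integral_eq_one : ∫ x, φ x = 1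
  support_subset : Function.support φ ⊆ Metric.closedBall 0 ε
  radial : ∀ x y, ‖x‖ = ‖y‖ → φ x = φ y

/-- Mathlib's `ContDiffBump` on `ℝ^N` is not known to depend only on the norm, so a radial bump is
obtained by composing a bump function of one variable with `‖x‖²`. -/
theorem exists_radialBump (N : ℕ) : ∃ η : E N → ℝ, ContDiff ℝ ∞ η ∧ (∀ x, 0 ≤ η x) ∧
    (∀ x, η x ≤ 1) ∧ (∀ x, ‖x‖ ≤ 1 → η x = 1) ∧ Function.support η ⊆ Metric.closedBall 0 2 ∧
    ∀ x y, ‖x‖ = ‖y‖ → η x = η y := by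
  let b : ContDiffBump (0 : ℝ) := ⟨1, 4, by norm_num, by norm_num⟩
  refine ⟨fun x => b (‖x‖ ^ 2), b.contDiff.comp (contDiff_norm_sq ℝ), fun x => b.nonneg,
    fun x => b.le_one, fun x hx => ?_, fun x hx => ?_, fun x y h => by simp only [h]⟩
  · apply b.one_of_mem_closedBall
    rw [mem_closedBall_zero_iff, Real.norm_of_nonneg (sq_nonneg _)]
    change ‖x‖ ^ 2 ≤ 1
    nlinarith [norm_nonneg x]
  · rw [mem_closedBall_zero_iff]
    by_contra! h
    apply hx
    apply b.zero_of_le_dist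
    rw [dist_zero_right, Real.norm_of_nonneg (sq_nonneg _)]
    change 4 ≤ ‖x‖ ^ 2
    nlinarith [norm_nonneg x]

theorem hasCompactSupport_of_support_subset {F : Type*} [Zero F] {φ : E N → F} {ε : ℝ}
    (h : Function.support φ ⊆ Metric.closedBall 0 ε) : HasCompactSupport φ :=
  HasCompactSupport.of_support_subset_isCompact (isCompact_closedBall 0 ε) h

theorem IsRadialMollifier.hasCompactSupport {φ : E N → ℝ} {ε : ℝ} (h : IsRadialMollifier φ ε) :
    HasCompactSupport φ :=
  hasCompactSupport_of_support_subset h.support_subset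

/-- The bound by a multiple of the reciprocal volume of the ball is what the Lebesgue
differentiation theorem needs in `ae_tendsto_mollify`. -/
theorem exists_isRadialMollifier (N : ℕ) : ∃ K : ℝ, ∀ ε : ℝ, 0 < ε → ∃ φ : E N → ℝ,
    IsRadialMollifier φ ε ∧ ∀ x, φ x ≤ K / volume.real (Metric.closedBall (0 : E N) ε) := by
  obtain ⟨η, hs, h0, h1, hη1, hsupp, hrad⟩ := exists_radialBump N
  have hpos : 0 < ∫ x, η x := by
    rw [integral_pos_iff_support_of_nonneg h0
      (hs.continuous.integrable_of_hasCompactSupport (hasCompactSupport_of_support_subset hsupp))]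
    refine hs.continuous.isOpen_support.measure_pos _ ⟨0, ?_⟩
    simp [hη1 0 (by simp)]
  refine ⟨volume.real (Metric.closedBall (0 : E N) 2) / ∫ x, η x, fun ε hε => ?_⟩
  set δ : ℝ := ε / 2 with hδ
  have hδ0 : 0 < δ := by positivity
  have hδN : (0:ℝ) < δ ^ N := by positivity
  have hint : ∫ x : E N, η (δ⁻¹ • x) = δ ^ N * ∫ x, η x := by
    rw [Measure.integral_comp_inv_smul]
    simp [abs_of_pos hδN]
  refine ⟨fun x => η (δ⁻¹ • x) / (δ ^ N * ∫ x, η x), ⟨?_, ?_, ?_, ?_, ?_⟩, ?_⟩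
  · exact (hs.comp (contDiff_const_smul _)).div_const _
  · exact fun x => div_nonneg (h0 _) (by positivity)
  · rw [integral_div, hint, div_self (by positivity)]
  · intro x hx
    have : δ⁻¹ • x ∈ Function.support η := by
      intro h
      apply hx
      simp [h]
    have := hsupp this
    rw [mem_closedBall_zero_iff, norm_smul, Real.norm_of_nonneg (by positivity),
      inv_mul_le_iff₀ hδ0] at this
    rw [mem_closedBall_zero_iff]
    linarith
  · intro x y h
    have : ‖δ⁻¹ • x‖ = ‖δ⁻¹ • y‖ := by rw [norm_smul, norm_smul, h]
    simp only [hrad _ _ this]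
  · intro x
    have h2 : volume.real (Metric.closedBall (0 : E N) ε)
        = δ ^ N * volume.real (Metric.closedBall (0 : E N) 2) := by
      rw [show ε = δ * 2 by rw [hδ]; ring, measureReal_def, measureReal_def,
        Measure.addHaar_closedBall_mul (volume : Measure (E N)) 0 hδ0.le (by norm_num)]
      simp [ENNReal.toReal_ofReal hδN.le]
    have h3 : 0 < volume.real (Metric.closedBall (0 : E N) 2) :=
      ENNReal.toReal_pos (Metric.measure_closedBall_pos _ _ (by norm_num)).ne'
        measure_closedBall_lt_top.ne
    rw [h2, div_div, mul_comm (∫ x, η x), mul_right_comm, mul_comm (_ * _) (volume.real _),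
      ← div_div, div_self h3.ne']
    exact div_le_div_of_nonneg_right (h1 _) (by positivity)

section
variable {F : Type*} [NormedAddCommGroup F] [NormedSpace ℝ F]

/-- The convolution of a scalar kernel `φ` with a (possibly vector-valued) function `g`. -/
noncomputable def mollify (φ : E N → ℝ) (g : E N → F) (x : E N) : F := ∫ t, φ (x - t) • g t

theorem integrable_mollify_integrand {φ : E N → ℝ} {ε : ℝ} (h : IsRadialMollifier φ ε) {g : E N → F}
    (hg : LocallyIntegrable g volume) (x : E N) : Integrable (fun t => φ (x - t) • g t) volume := by
  refine hg.integrable_smul_left_of_hasCompactSupport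
    (h.contDiff.continuous.comp (continuous_const.sub continuous_id)) ?_
  exact h.hasCompactSupport.comp_homeomorph (Homeomorph.subLeft x)

theorem mollify_eq_convolution (φ : E N → ℝ) (v : E N → ℝ) :
    mollify φ v = (v ⋆[ContinuousLinearMap.lsmul ℝ ℝ, volume] φ) := by
  ext x
  simp [mollify, convolution_def, mul_comm]

theorem contDiff_mollify {φ : E N → ℝ} {ε : ℝ} (h : IsRadialMollifier φ ε) {v : E N → ℝ}
    (hv : LocallyIntegrable v volume) : ContDiff ℝ ∞ (mollify φ v) := by
  rw [mollify_eq_convolution]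
  exact h.hasCompactSupport.contDiff_convolution_right _ hv h.contDiff

/-- Mollification turns a weak gradient into a classical one: `∇(φ ∗ v) = φ ∗ ∇v`. -/
theorem fderiv_mollify {φ : E N → ℝ} {ε : ℝ} (h : IsRadialMollifier φ ε) {v : E N → ℝ}
    {g : E N → E N} (hg : IsWeakGradient v g) (x : E N) :
    fderiv ℝ (mollify φ v) x = innerSL ℝ (mollify φ g x) := by
  have hd := h.hasCompactSupport.hasFDerivAt_convolution_right (ContinuousLinearMap.lsmul ℝ ℝ)
    hg.1 (h.contDiff.of_le (by simp)) x
  rw [mollify_eq_convolution, hd.fderiv]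
  have hcs : HasCompactSupport (fderiv ℝ φ) := h.hasCompactSupport.fderiv (𝕜 := ℝ)
  have hcd : Continuous (fderiv ℝ φ) := h.contDiff.continuous_fderiv (by simp)
  refine ContinuousLinearMap.coe_injective
    ((EuclideanSpace.basisFun (Fin N) ℝ).toBasis.ext fun i => ?_)
  simp only [OrthonormalBasis.coe_toBasis, EuclideanSpace.basisFun_apply,
    ContinuousLinearMap.coe_coe]
  rw [convolution_precompR_apply _ hg.1 hcs hcd]
  have hwk := hg.2.2 (fun t => φ (x - t)) (h.contDiff.comp (contDiff_const.sub contDiff_id))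
    (h.hasCompactSupport.comp_homeomorph (Homeomorph.subLeft x)) i
  have hder : ∀ t, fderiv ℝ (fun t => φ (x - t)) t = - fderiv ℝ φ (x - t) := by
    intro t
    have h1 := ((h.contDiff.differentiable (by simp)) (x - t)).hasFDerivAt.comp t
      ((hasFDerivAt_id t).const_sub x)
    rw [Function.comp_def] at h1
    rw [h1.fderiv]
    ext y
    simp
  simp only [hder, _root_.neg_apply, mul_neg, integral_neg, neg_inj] at hwk
  have h1 : mollify φ g x i = ∫ t, g t i * φ (x - t) := by
    have := (EuclideanSpace.proj (𝕜 := ℝ) i).integral_comp_comm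
      (integrable_mollify_integrand h hg.2.1 x)
    simp only [PiLp.proj_apply, PiLp.smul_apply, smul_eq_mul] at this
    rw [mollify, ← this]
    simp only [mul_comm]
  rw [convolution_def, innerSL_apply_apply, EuclideanSpace.inner_single_right]
  simp only [ContinuousLinearMap.lsmul_apply, smul_eq_mul, hwk, h1]
  simp

theorem lintegral_kernel {φ : E N → ℝ} {ε : ℝ} (h : IsRadialMollifier φ ε) :
    ∫⁻ t, ENNReal.ofReal (φ t) = 1 := by
  rw [← ofReal_integral_eq_lintegral_ofReal
    (h.contDiff.continuous.integrable_of_hasCompactSupport h.hasCompactSupport)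
    (ae_of_all _ h.nonneg), h.integral_eq_one, ENNReal.ofReal_one]

/-- Jensen's inequality for the probability density `t ↦ φ (x - t)`. -/
theorem enorm_mollify_sq_le {φ : E N → ℝ} {ε : ℝ} (h : IsRadialMollifier φ ε) {g : E N → F}
    (hg : LocallyIntegrable g volume) (x : E N) :
    ‖mollify φ g x‖ₑ ^ 2 ≤ ∫⁻ t, ENNReal.ofReal (φ (x - t)) * ‖g t‖ₑ ^ 2 := by
  have hm : Measurable fun t => ENNReal.ofReal (φ (x - t)) :=
    (h.contDiff.continuous.comp (continuous_const.sub continuous_id)).measurable.ennreal_ofReal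
  have h1 : ‖mollify φ g x‖ₑ ≤ ∫⁻ t, (ENNReal.ofReal (φ (x - t)) * ‖g t‖ₑ ^ 2) ^ (1 / 2 : ℝ) *
      ENNReal.ofReal (φ (x - t)) ^ (1 / 2 : ℝ) := by
    refine (enorm_integral_le_lintegral_enorm _).trans (lintegral_mono fun t => ?_)
    rw [enorm_smul, Real.enorm_of_nonneg (h.nonneg _),
      ENNReal.mul_rpow_of_nonneg _ _ (by norm_num), mul_right_comm,
      ← ENNReal.rpow_add_of_nonneg _ _ (by norm_num) (by norm_num), ← ENNReal.rpow_natCast_mul]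
    norm_num
  have h2 := h1.trans (ENNReal.lintegral_mul_norm_pow_le
    (hm.aemeasurable.mul (hg.aestronglyMeasurable.enorm.pow_const 2)) hm.aemeasurable
    (by norm_num) (by norm_num) (by norm_num))
  have h3 : ∫⁻ t, ENNReal.ofReal (φ (x - t)) = 1 := by
    rw [lintegral_sub_left_eq_self (fun t => ENNReal.ofReal (φ t)) x, lintegral_kernel h]
  rw [h3, ENNReal.one_rpow, mul_one] at h2
  refine (pow_le_pow_left₀ (zero_le) h2 2).trans ?_
  rw [← ENNReal.rpow_mul_natCast]
  norm_num

/-- Mollification is a contraction between weighted `L²` spaces as soon as the weight `W` at a point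
is dominated by the weight `V` at almost all points within distance `ε`. -/
theorem lintegral_mul_enorm_mollify_sq_le {φ : E N → ℝ} {ε : ℝ} (h : IsRadialMollifier φ ε)
    {g : E N → F} (hg : LocallyIntegrable g volume) {V W : E N → ℝ≥0∞}
    (hV : Measurable V)
    (hVW : ∀ x, ∀ᵐ t, ‖x - t‖ ≤ ε → W x ≤ V t) :
    ∫⁻ x, W x * ‖mollify φ g x‖ₑ ^ 2 ≤ ∫⁻ t, V t * ‖g t‖ₑ ^ 2 := by
  have hm : Measurable fun p : E N × E N => ENNReal.ofReal (φ (p.1 - p.2)) :=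
    (h.contDiff.continuous.comp (continuous_fst.sub continuous_snd)).measurable.ennreal_ofReal
  have hm' : ∀ x, Measurable fun t => ENNReal.ofReal (φ (x - t)) := fun x =>
    hm.comp measurable_prodMk_left
  have hge := hg.aestronglyMeasurable.enorm
  calc ∫⁻ x, W x * ‖mollify φ g x‖ₑ ^ 2
      ≤ ∫⁻ x, ∫⁻ t, ENNReal.ofReal (φ (x - t)) * (V t * ‖g t‖ₑ ^ 2) := by
        refine lintegral_mono fun x => ?_
        calc W x * ‖mollify φ g x‖ₑ ^ 2
            ≤ W x * ∫⁻ t, ENNReal.ofReal (φ (x - t)) * ‖g t‖ₑ ^ 2 := by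
              gcongr; exact enorm_mollify_sq_le h hg x
          _ = ∫⁻ t, W x * (ENNReal.ofReal (φ (x - t)) * ‖g t‖ₑ ^ 2) :=
              (lintegral_const_mul'' _
                ((hm' x).aemeasurable.mul (hge.pow_const 2))).symm
          _ ≤ _ := by
              refine lintegral_mono_ae ?_
              filter_upwards [hVW x] with t ht
              by_cases hφ : φ (x - t) = 0
              · simp [hφ]
              · have := ht (mem_closedBall_zero_iff.1 (h.support_subset hφ))
                calc W x * (ENNReal.ofReal (φ (x - t)) * ‖g t‖ₑ ^ 2)
                    ≤ V t * (ENNReal.ofReal (φ (x - t)) * ‖g t‖ₑ ^ 2) := by gcongr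
                  _ = _ := by ring
    _ = ∫⁻ t, ∫⁻ x, ENNReal.ofReal (φ (x - t)) * (V t * ‖g t‖ₑ ^ 2) := by
        refine lintegral_lintegral_swap ?_
        refine hm.aemeasurable.mul ?_
        exact (hV.aemeasurable.mul (hge.pow_const 2)).comp_quasiMeasurePreserving
          Measure.quasiMeasurePreserving_snd
    _ = ∫⁻ t, V t * ‖g t‖ₑ ^ 2 := by
        refine lintegral_congr fun t => ?_
        have hmt : Measurable fun x => ENNReal.ofReal (φ (x - t)) :=
          hm.comp measurable_prodMk_right
        rw [lintegral_mul_const _ hmt,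
          lintegral_sub_right_eq_self (fun x => ENNReal.ofReal (φ x)) t,
          lintegral_kernel h, one_mul]

theorem lintegral_enorm_mollify_sq_le {φ : E N → ℝ} {ε : ℝ} (h : IsRadialMollifier φ ε)
    {g : E N → F} (hg : LocallyIntegrable g volume) :
    ∫⁻ x, ‖mollify φ g x‖ₑ ^ 2 ≤ ∫⁻ t, ‖g t‖ₑ ^ 2 := by
  simpa using lintegral_mul_enorm_mollify_sq_le h hg (V := 1) (W := 1) measurable_one (by simp)

theorem hasCompactSupport_mollify {φ : E N → ℝ} {ε : ℝ} (h : IsRadialMollifier φ ε) {v : E N → ℝ}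
    (hv : HasCompactSupport v) : HasCompactSupport (mollify φ v) := by
  rw [mollify_eq_convolution]
  exact hv.convolution _ h.hasCompactSupport

/-- Radiality of `v` holds up to null sets, that of its mollification pointwise. -/
theorem mollify_comp_isometry {φ : E N → ℝ} {ε : ℝ} (h : IsRadialMollifier φ ε) {v : E N → ℝ}
    (hv : IsRadial v) (S : E N ≃ₗᵢ[ℝ] E N) (x : E N) : mollify φ v (S x) = mollify φ v x := by
  unfold mollify
  rw [← S.measurePreserving.integral_comp S.toHomeomorph.measurableEmbedding]
  refine integral_congr_ae ?_
  filter_upwards [hv S] with t ht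
  rw [ht, ← map_sub, h.radial _ _ (S.norm_map (x - t))]

/-- Almost everywhere convergence of mollifications, at the Lebesgue points of `v`. -/
theorem ae_tendsto_mollify {φ : ℕ → E N → ℝ} {ε : ℕ → ℝ} {K : ℝ}
    (h : ∀ n, IsRadialMollifier (φ n) (ε n)) (hε : ∀ n, 0 < ε n) (hε0 : Tendsto ε atTop (𝓝 0))
    (hK : ∀ n x, φ n x ≤ K / volume.real (Metric.closedBall (0 : E N) (ε n))) {v : E N → ℝ}
    (hv : LocallyIntegrable v volume) :
    ∀ᵐ x, Tendsto (fun n => mollify (φ n) v x) atTop (𝓝 (v x)) := by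
  filter_upwards [(Besicovitch.vitaliFamily volume).ae_tendsto_average_norm_sub hv] with x₀ h₀
  have hφ' : Tendsto ε atTop (𝓝[>] 0) :=
    tendsto_nhdsWithin_iff.2 ⟨hε0, Eventually.of_forall hε⟩
  have := (h₀.comp (Besicovitch.tendsto_filterAt volume x₀)).comp hφ'
  apply tendsto_integral_smul_of_tendsto_average_norm_sub K this
  · filter_upwards with i using hv.integrableOn_isCompact (isCompact_closedBall _ _)
  · apply tendsto_const_nhds.congr (fun i ↦ ?_)
    rw [integral_sub_left_eq_self (fun t => φ i t), (h i).integral_eq_one]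
  · filter_upwards with i
    intro t ht
    have := mem_closedBall_zero_iff.1 ((h i).support_subset ht)
    rwa [Metric.mem_closedBall, dist_comm, dist_eq_norm]
  · filter_upwards with i x
    rw [abs_of_nonneg ((h i).nonneg _), Measure.addHaar_real_closedBall_center]
    exact hK i _

end

/-! ### The Sobolev inequality in `D^{1,2}` -/

theorem two_lt_twoStar (hN : 3 ≤ N) : 2 < twoStar N := by
  have : (3:ℝ) ≤ N := by exact_mod_cast hN
  rw [twoStar, lt_div_iff₀ (by linarith)]
  linarith

theorem inv_twoStar (hN : 3 ≤ N) : (twoStar N)⁻¹ = 2⁻¹ - (N : ℝ)⁻¹ := by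
  have : (3:ℝ) ≤ N := by exact_mod_cast hN
  rw [twoStar]
  have : (N:ℝ) - 2 ≠ 0 := by linarith
  field_simp

theorem enorm_fderiv_mollify {φ : E N → ℝ} {ε : ℝ} (h : IsRadialMollifier φ ε) {v : E N → ℝ}
    {g : E N → E N} (hg : IsWeakGradient v g) (x : E N) :
    ‖fderiv ℝ (mollify φ v) x‖ₑ = ‖mollify φ g x‖ₑ := by
  rw [fderiv_mollify h hg, ← ofReal_norm, ← ofReal_norm, innerSL_apply_norm]

theorem exists_mollifier_seq (N : ℕ) : ∃ φ : ℕ → E N → ℝ, ∃ ε : ℕ → ℝ,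
    (∀ n, IsRadialMollifier (φ n) (ε n)) ∧ (∀ n, 0 < ε n) ∧ Tendsto ε atTop (𝓝 0) ∧
    ∀ v : E N → ℝ, LocallyIntegrable v volume →
      ∀ᵐ x, Tendsto (fun n => mollify (φ n) v x) atTop (𝓝 (v x)) := by
  obtain ⟨K, hK⟩ := exists_isRadialMollifier N
  choose φ hφ hb using fun n : ℕ => hK (1 / ((n : ℝ) + 1)) (by positivity)
  exact ⟨φ, fun n => 1 / ((n : ℝ) + 1), hφ, fun n => by positivity,
    tendsto_one_div_add_atTop_nhds_zero_nat,
    fun v hv => ae_tendsto_mollify hφ (fun n => by positivity)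
      tendsto_one_div_add_atTop_nhds_zero_nat hb hv⟩

theorem eLpNorm_two_sq {F : Type*} [NormedAddCommGroup F] (g : E N → F) :
    eLpNorm g 2 volume = (∫⁻ x, ‖g x‖ₑ ^ 2) ^ (1 / 2 : ℝ) := by
  rw [eLpNorm_eq_lintegral_rpow_enorm_toReal (by norm_num) (by norm_num)]
  simp

/-- The Sobolev inequality passes from the mollifications of `v` to `v` by Fatou's lemma. -/
theorem exists_sobolev_compactSupport (hN : 3 ≤ N) : ∃ C : ℝ≥0, ∀ (v : E N → ℝ) (g : E N → E N),
    HasCompactSupport v → IsWeakGradient v g →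
    eLpNorm v (ENNReal.ofReal (twoStar N)) volume ≤ C * eLpNorm g 2 volume := by
  have h2 := two_lt_twoStar hN
  refine ⟨SNormLESNormFDerivOfEqConst ℝ (volume : Measure (E N)) (2 : ℝ≥0), fun v g hv hg => ?_⟩
  obtain ⟨φ, ε, hφ, hε, hε0, hlim⟩ := exists_mollifier_seq N
  have hle : ∀ n, eLpNorm (mollify (φ n) v) (ENNReal.ofReal (twoStar N)) volume ≤
      SNormLESNormFDerivOfEqConst ℝ (volume : Measure (E N)) (2 : ℝ≥0) * eLpNorm g 2 volume := by
    intro n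
    have hsob := eLpNorm_le_eLpNorm_fderiv_of_eq (volume : Measure (E N))
      ((contDiff_mollify (hφ n) hg.1).of_le (by simp)) (hasCompactSupport_mollify (hφ n) hv)
      (p := 2) (p' := (twoStar N).toNNReal) (by norm_num) (by simp; omega) (by
        rw [Real.coe_toNNReal _ (by linarith), inv_twoStar hN]; simp)
    refine (hsob.trans ?_)
    gcongr
    rw [ENNReal.coe_ofNat 2, eLpNorm_two_sq, eLpNorm_two_sq]
    simp only [enorm_fderiv_mollify (hφ n) hg]
    exact ENNReal.rpow_le_rpow (lintegral_enorm_mollify_sq_le (hφ n) hg.2.1) (by norm_num)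
  refine (Lp.eLpNorm_lim_le_liminf_eLpNorm
    (fun n => (contDiff_mollify (hφ n) hg.1).continuous.aestronglyMeasurable) v
    (hlim v hg.1)).trans ?_
  exact liminf_le_of_le (by isBoundedDefault) fun b hb => by
    obtain ⟨n, hn⟩ := hb.exists
    exact hn.trans (hle n)

theorem continuous_gradient {u : E N → ℝ} (hu : ContDiff ℝ ∞ u) : Continuous (gradient u) :=
  (InnerProductSpace.toDual ℝ (E N)).symm.continuous.comp (hu.continuous_fderiv (by simp))

theorem gradient_apply (u : E N → ℝ) (x : E N) (i : Fin N) :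
    gradient u x i = fderiv ℝ u x (EuclideanSpace.single i 1) := by
  have : fderiv ℝ u x (EuclideanSpace.single i 1) =
      inner ℝ (gradient u x) (EuclideanSpace.single i 1) := by
    rw [gradient, InnerProductSpace.toDual_symm_apply]
  rw [this, EuclideanSpace.inner_single_right]
  simp

/-- The Leibniz rule `∇(χ u) = χ ∇u + u ∇χ` for a smooth factor `χ`. -/
theorem IsWeakGradient.mul_left {u : E N → ℝ} {g : E N → E N} (hg : IsWeakGradient u g)
    {χ : E N → ℝ} (hχ : ContDiff ℝ ∞ χ) :
    IsWeakGradient (fun x => χ x * u x) (fun x => χ x • g x + u x • gradient χ x) := by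
  have hχc : Continuous χ := hχ.continuous
  have hgc := continuous_gradient hχ
  have hgi := gradient_apply χ
  have hloc : LocallyIntegrable (fun x => u x • gradient χ x) volume := by
    rw [← locallyIntegrableOn_univ]
    exact (locallyIntegrableOn_univ.2 hg.1).smul_continuousOn
      isClosed_univ.isLocallyClosed hgc.continuousOn
  refine ⟨?_, ?_, ?_⟩
  · rw [← locallyIntegrableOn_univ]
    exact (locallyIntegrableOn_univ.2 hg.1).continuousOn_mul hχc.continuousOn
      isClosed_univ.isLocallyClosed
  · refine LocallyIntegrable.add ?_ hloc
    rw [← locallyIntegrableOn_univ]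
    exact (locallyIntegrableOn_univ.2 hg.2.1).continuousOn_smul
      isClosed_univ.isLocallyClosed hχc.continuousOn
  · intro φ hφ hc i
    have hw := hg.2.2 (fun x => χ x * φ x) (hχ.mul hφ) (hc.mul_left) i
    set e : E N := EuclideanSpace.single i 1
    have hder : ∀ x, fderiv ℝ (fun x => χ x * φ x) x e
        = χ x * fderiv ℝ φ x e + φ x * fderiv ℝ χ x e := by
      intro x
      rw [fderiv_fun_mul (hχ.differentiable (by simp) x) (hφ.differentiable (by simp) x)]
      simp
    simp only [hder] at hw
    have hcφ' : HasCompactSupport (fun x => fderiv ℝ φ x e) := hc.fderiv_apply (𝕜 := ℝ) e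
    have hφ'c : Continuous (fun x => fderiv ℝ φ x e) :=
      (hφ.continuous_fderiv (by simp)).clm_apply continuous_const
    have hχ'c : Continuous (fun x => fderiv ℝ χ x e) :=
      (hχ.continuous_fderiv (by simp)).clm_apply continuous_const
    have i1 : Integrable (fun x => (χ x * fderiv ℝ φ x e) • u x) volume :=
      hg.1.integrable_smul_left_of_hasCompactSupport (hχc.mul hφ'c) hcφ'.mul_left
    have i2 : Integrable (fun x => (φ x * fderiv ℝ χ x e) • u x) volume :=
      hg.1.integrable_smul_left_of_hasCompactSupport (hφ.continuous.mul hχ'c) hc.mul_right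
    have hgl : LocallyIntegrable (fun x => g x i) volume := by
      intro x
      obtain ⟨s, hs, hi⟩ := hg.2.1 x
      exact ⟨s, hs, (EuclideanSpace.proj (𝕜 := ℝ) i).integrable_comp hi⟩
    have i3 : Integrable (fun x => (χ x * φ x) • g x i) volume :=
      hgl.integrable_smul_left_of_hasCompactSupport (hχc.mul hφ.continuous) hc.mul_left
    simp only [smul_eq_mul] at i1 i2 i3
    have e1 : ∫ x, u x * (χ x * fderiv ℝ φ x e + φ x * fderiv ℝ χ x e)
        = (∫ x, χ x * fderiv ℝ φ x e * u x) + ∫ x, φ x * fderiv ℝ χ x e * u x := by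
      rw [← integral_add i1 i2]
      congr 1; ext x; ring
    have e2 : ∫ x, (χ x • g x + u x • gradient χ x) i * φ x
        = (∫ x, χ x * φ x * g x i) + ∫ x, φ x * fderiv ℝ χ x e * u x := by
      rw [← integral_add i3 i2]
      congr 1; ext x
      simp only [PiLp.add_apply, PiLp.smul_apply, smul_eq_mul, hgi]
      ring
    have e3 : ∫ x, g x i * (χ x * φ x) = ∫ x, χ x * φ x * g x i := by
      congr 1; ext x; ring
    have e4 : ∫ x, χ x * u x * fderiv ℝ φ x e = ∫ x, χ x * fderiv ℝ φ x e * u x := by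
      congr 1; ext x; ring
    rw [e4, e2]
    rw [e1, e3] at hw
    linarith

theorem norm_gradient_eq (χ : E N → ℝ) (x : E N) : ‖gradient χ x‖ = ‖fderiv ℝ χ x‖ := by
  rw [gradient, LinearIsometryEquiv.norm_map]

/-- Cutoff functions at scale `n`. Their gradients are of size `1 / n` on a ball of radius
comparable to `n`, hence bounded in the scale-invariant space `L^N`. -/
theorem exists_cutoff_seq (hN : 3 ≤ N) : ∃ χ : ℕ → E N → ℝ,
    (∀ n, ContDiff ℝ ∞ (χ n)) ∧ (∀ n x, 0 ≤ χ n x) ∧ (∀ n x, χ n x ≤ 1) ∧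
    (∀ (n : ℕ) x, ‖x‖ ≤ n → χ n x = 1) ∧ (∀ n, HasCompactSupport (χ n)) ∧
    (∀ n x y, ‖x‖ = ‖y‖ → χ n x = χ n y) ∧ (∀ (n : ℕ) x, ‖x‖ < n → gradient (χ n) x = 0) ∧
    ∃ C : ℝ≥0, ∀ n, eLpNorm (gradient (χ n)) N volume ≤ C := by
  obtain ⟨η, hs, h0, h1, hη1, hsupp, hrad⟩ := exists_radialBump N
  have hN0 : (N : ℝ≥0∞) ≠ 0 := by simp; omega
  have hcs := hasCompactSupport_of_support_subset hsupp
  obtain ⟨B, hB⟩ := (hs.continuous_fderiv (by simp)).bounded_above_of_compact_support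
    (hcs.fderiv (𝕜 := ℝ))
  have hB0 : 0 ≤ B := (norm_nonneg _).trans (hB 0)
  have hpos : ∀ n : ℕ, (0:ℝ) < n + 1 := fun n => by positivity
  have hη1' : ∀ x : E N, ∀ n : ℕ, ‖x‖ ≤ n → η (((n:ℝ) + 1)⁻¹ • x) = 1 := fun x n hx => by
    apply hη1
    rw [norm_smul, Real.norm_of_nonneg (by positivity), inv_mul_le_iff₀ (hpos n)]
    linarith
  have hsupp' : ∀ n : ℕ, Function.support (fun x => η (((n:ℝ) + 1)⁻¹ • x)) ⊆
      Metric.closedBall 0 (((n:ℝ) + 1) * 2) := fun n x hx => by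
    have := mem_closedBall_zero_iff.1 (hsupp (a := ((n:ℝ) + 1)⁻¹ • x) hx)
    rw [norm_smul, Real.norm_of_nonneg (by positivity), inv_mul_le_iff₀ (hpos n)] at this
    rwa [mem_closedBall_zero_iff]
  refine ⟨fun n x => η (((n:ℝ) + 1)⁻¹ • x), fun n => hs.comp (contDiff_const_smul _),
    fun n x => h0 _, fun n x => h1 _, fun n x hx => hη1' x n hx,
    fun n => hasCompactSupport_of_support_subset (hsupp' n), fun n x y h => ?_,
    fun n x hx => ?_, ?_⟩
  · exact hrad _ _ (by rw [norm_smul, norm_smul, h])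
  · have : (fun x => η (((n:ℝ) + 1)⁻¹ • x)) =ᶠ[𝓝 x] fun _ => 1 := by
      filter_upwards [(isOpen_lt continuous_norm continuous_const).mem_nhds hx] with y hy
      exact hη1' y n (le_of_lt hy)
    rw [gradient, this.fderiv_eq]
    simp
  · set D : ℝ≥0∞ := ENNReal.ofReal B * volume (Metric.closedBall (0 : E N) 2) ^ (1 / (N : ℝ))
      with hD
    have hDtop : D ≠ ⊤ := ENNReal.mul_ne_top ENNReal.ofReal_ne_top
      (ENNReal.rpow_ne_top_of_nonneg (by positivity) measure_closedBall_lt_top.ne)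
    refine ⟨D.toNNReal, fun n => ?_⟩
    rw [ENNReal.coe_toNNReal hDtop]
    have hbd : ∀ x, ‖gradient (fun x => η (((n:ℝ) + 1)⁻¹ • x)) x‖ ≤
        ‖(Metric.closedBall (0 : E N) (((n:ℝ) + 1) * 2)).indicator
          (fun _ => ((n:ℝ) + 1)⁻¹ * B) x‖ := by
      intro x
      rw [norm_gradient_eq]
      by_cases hx : x ∈ Metric.closedBall (0 : E N) (((n:ℝ) + 1) * 2)
      · rw [indicator_of_mem hx, fderiv_comp_smul, norm_smul, Real.norm_of_nonneg (by positivity),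
          Real.norm_of_nonneg (by positivity)]
        gcongr
        exact hB _
      · rw [indicator_of_notMem hx]
        have : fderiv ℝ (fun x => η (((n:ℝ) + 1)⁻¹ • x)) x = 0 := by
          by_contra h
          have h1 := support_fderiv_subset ℝ (Function.mem_support.2 h)
          exact hx (closure_minimal (hsupp' n) Metric.isClosed_closedBall h1)
        simp [this]
    refine (eLpNorm_mono hbd).trans ?_
    rw [eLpNorm_indicator_const Metric.isClosed_closedBall.measurableSet hN0 (by simp),
      Measure.addHaar_closedBall_mul _ _ (hpos n).le (by norm_num), ENNReal.toReal_natCast,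
      ENNReal.mul_rpow_of_nonneg _ _ (by positivity), finrank_euclideanSpace_fin,
      ENNReal.ofReal_rpow_of_nonneg (by positivity) (by positivity), one_div,
      Real.pow_rpow_inv_natCast (hpos n).le (by omega), Real.enorm_of_nonneg (by positivity),
      ← mul_assoc, ← ENNReal.ofReal_mul (by positivity), hD, one_div]
    refine le_of_eq ?_
    congr 2
    have := (hpos n).ne'
    field_simp

theorem tendsto_eLpNorm_tail {u : E N → ℝ} {q : ℝ} (hq : 0 < q)
    (hu : MemLp u (ENNReal.ofReal q) volume) :
    Tendsto (fun n : ℕ => eLpNorm ({x : E N | (n : ℝ) ≤ ‖x‖}.indicator u) (ENNReal.ofReal q) volume)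
      atTop (𝓝 0) := by
  have hq0 : ENNReal.ofReal q ≠ 0 := by simpa using hq
  have hfin := lintegral_rpow_enorm_lt_top_of_eLpNorm_lt_top hq0 ENNReal.ofReal_ne_top hu.2
  rw [ENNReal.toReal_ofReal hq.le] at hfin
  have hms : ∀ n : ℕ, MeasurableSet {x : E N | (n : ℝ) ≤ ‖x‖} := fun n =>
    measurableSet_le measurable_const measurable_norm
  have key : Tendsto (fun n : ℕ => ∫⁻ x, ‖({x : E N | (n : ℝ) ≤ ‖x‖}.indicator u) x‖ₑ ^ q)
      atTop (𝓝 (∫⁻ _ : E N, 0)) := by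
    refine tendsto_lintegral_of_dominated_convergence' (fun x => ‖u x‖ₑ ^ q)
      (fun n => ((hu.1.indicator (hms n)).enorm.pow_const q)) (fun n => ae_of_all _ fun x => ?_)
      hfin.ne (ae_of_all _ fun x => ?_)
    · exact ENNReal.rpow_le_rpow ((enorm_indicator_le_enorm_self _ _).trans_eq (by simp)) hq.le
    · refine tendsto_const_nhds.congr' ?_
      filter_upwards [eventually_gt_atTop ⌈‖x‖⌉₊] with n hn
      have : ‖x‖ < n := (Nat.le_ceil _).trans_lt (by exact_mod_cast hn)
      rw [indicator_of_notMem (by simpa using this)]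
      simp [hq]
  rw [lintegral_zero] at key
  have := (ENNReal.continuous_rpow_const (y := 1 / q)).tendsto 0 |>.comp key
  rw [ENNReal.zero_rpow_of_pos (by positivity)] at this
  refine this.congr fun n => ?_
  rw [eLpNorm_eq_lintegral_rpow_enorm_toReal hq0 ENNReal.ofReal_ne_top, ENNReal.toReal_ofReal hq.le]
  rfl

/-- The error term `u ∇χ_n` of a cutoff vanishes in `L²`, by Hölder's inequality with
`1 / 2 = 1 / 2^* + 1 / N`. -/
theorem tendsto_eLpNorm_smul_gradient_cutoff (hN : 3 ≤ N) {χ : ℕ → E N → ℝ}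
    (hχ : ∀ n, ContDiff ℝ ∞ (χ n))
    (hgr : ∀ (n : ℕ) x, ‖x‖ < n → gradient (χ n) x = 0) {C : ℝ≥0}
    (hC : ∀ n, eLpNorm (gradient (χ n)) N volume ≤ C) {u : E N → ℝ}
    (hu : MemLp u (ENNReal.ofReal (twoStar N)) volume) :
    Tendsto (fun n => eLpNorm (fun x => u x • gradient (χ n) x) 2 volume) atTop (𝓝 0) := by
  have h2 := two_lt_twoStar hN
  have hms : ∀ n : ℕ, MeasurableSet {x : E N | (n : ℝ) ≤ ‖x‖} := fun n =>
    measurableSet_le measurable_const measurable_norm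
  have htri : ENNReal.HolderTriple (ENNReal.ofReal (twoStar N)) N 2 := by
    constructor
    have hNr : (3:ℝ) ≤ N := by exact_mod_cast hN
    rw [← ENNReal.ofReal_inv_of_pos (by linarith), ← ENNReal.ofReal_natCast,
      ← ENNReal.ofReal_inv_of_pos (by linarith), ← ENNReal.ofReal_add
        (by positivity) (by positivity), inv_twoStar hN, sub_add_cancel,
      ENNReal.ofReal_inv_of_pos (by norm_num)]
    simp
  have hle : ∀ n, eLpNorm (fun x => u x • gradient (χ n) x) 2 volume ≤
      eLpNorm ({x : E N | (n : ℝ) ≤ ‖x‖}.indicator u) (ENNReal.ofReal (twoStar N)) volume * C := by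
    intro n
    have hgc := continuous_gradient (hχ n)
    have : (fun x => u x • gradient (χ n) x) =
        ({x : E N | (n : ℝ) ≤ ‖x‖}.indicator u) • gradient (χ n) := by
      ext1 x
      by_cases hx : (n : ℝ) ≤ ‖x‖
      · simp [hx]
      · simp [hgr n x (not_le.1 hx)]
    rw [this]
    refine (eLpNorm_smul_le_mul_eLpNorm hgc.aestronglyMeasurable (hu.1.indicator (hms n))
      (p := ENNReal.ofReal (twoStar N)) (q := N)).trans ?_
    gcongr
    exact hC n
  have := ENNReal.Tendsto.mul_const (tendsto_eLpNorm_tail (by linarith) hu)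
    (Or.inr (ENNReal.coe_ne_top (r := C)))
  rw [zero_mul] at this
  exact tendsto_of_tendsto_of_tendsto_of_le_of_le tendsto_const_nhds this (fun _ => zero_le) hle

/-- Functions in `D^{1,2}` are approximated by compactly supported ones, `χ_n u`, without
increasing the `L²` norm of the gradient in the limit. -/
theorem exists_cutoff_approx (hN : 3 ≤ N) {u : E N → ℝ} {g : E N → E N}
    (hu : MemLp u (ENNReal.ofReal (twoStar N)) volume) (hg : IsWeakGradient u g)
    (hg2 : MemLp g 2 volume) : ∃ χ : ℕ → E N → ℝ, ∃ G : ℕ → E N → E N,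
    (∀ n, ContDiff ℝ ∞ (χ n)) ∧ (∀ n x, 0 ≤ χ n x) ∧ (∀ n x, χ n x ≤ 1) ∧
    (∀ (n : ℕ) x, ‖x‖ ≤ n → χ n x = 1) ∧ (∀ n, HasCompactSupport (χ n)) ∧
    (∀ n x y, ‖x‖ = ‖y‖ → χ n x = χ n y) ∧
    (∀ n, IsWeakGradient (fun x => χ n x * u x) (G n)) ∧
    ∀ η : ℝ≥0, 0 < η → ∀ᶠ n in atTop, eLpNorm (G n) 2 volume ≤ eLpNorm g 2 volume + η := by
  obtain ⟨χ, hχ, h0, h1, hχ1, hcs, hrad, hgr, C, hC⟩ := exists_cutoff_seq hN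
  refine ⟨χ, fun n x => χ n x • g x + u x • gradient (χ n) x, hχ, h0, h1, hχ1, hcs, hrad,
    fun n => hg.mul_left (hχ n), fun η hη => ?_⟩
  have ht := tendsto_eLpNorm_smul_gradient_cutoff hN hχ hgr hC hu
  filter_upwards [ht.eventually (gt_mem_nhds (show (0 : ℝ≥0∞) < η by simpa using hη))] with n hn
  have hgc := continuous_gradient (hχ n)
  refine (eLpNorm_add_le ((hχ n).continuous.aestronglyMeasurable.smul hg2.1)
    (hu.1.smul hgc.aestronglyMeasurable) (by norm_num)).trans ?_
  gcongr
  · refine eLpNorm_mono fun x => ?_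
    rw [Pi.smul_apply', norm_smul, Real.norm_of_nonneg (h0 n x)]
    exact mul_le_of_le_one_left (norm_nonneg _) (h1 n x)
  · exact hn.le

/-- The Sobolev inequality in `D^{1,2}(ℝ^N)`. -/
theorem exists_sobolev (hN : 3 ≤ N) : ∃ C : ℝ≥0, ∀ (u : E N → ℝ) (g : E N → E N),
    MemLp u (ENNReal.ofReal (twoStar N)) volume → IsWeakGradient u g → MemLp g 2 volume →
    eLpNorm u (ENNReal.ofReal (twoStar N)) volume ≤ C * eLpNorm g 2 volume := by
  obtain ⟨C, hC⟩ := exists_sobolev_compactSupport hN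
  refine ⟨C, fun u g hu hg hg2 => ?_⟩
  obtain ⟨χ, G, hχ, -, -, hχ1, hcs, -, hG, hle⟩ := exists_cutoff_approx hN hu hg hg2
  have hlim : ∀ x, Tendsto (fun n => χ n x * u x) atTop (𝓝 (u x)) := fun x => by
    refine tendsto_const_nhds.congr' ?_
    filter_upwards [eventually_ge_atTop ⌈‖x‖⌉₊] with n hn
    rw [hχ1 n x ((Nat.le_ceil _).trans (by exact_mod_cast hn)), one_mul]
  have hη : ∀ η : ℝ≥0, 0 < η → eLpNorm u (ENNReal.ofReal (twoStar N)) volume ≤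
      C * (eLpNorm g 2 volume + η) := by
    intro η hη
    refine (Lp.eLpNorm_lim_le_liminf_eLpNorm
      (fun n => (hχ n).continuous.aestronglyMeasurable.mul hu.1) u (ae_of_all _ hlim)).trans ?_
    refine liminf_le_of_le (by isBoundedDefault) fun b hb => ?_
    obtain ⟨n, hn, hn'⟩ := (hb.and (hle η hη)).exists
    refine hn.trans ((hC _ _ (hcs n).mul_right (hG n)).trans ?_)
    gcongr
  have ht : Tendsto (fun k : ℕ =>
      (C : ℝ≥0∞) * (eLpNorm g 2 volume + ((1 / ((k : ℝ≥0) + 1) : ℝ≥0) : ℝ≥0∞)))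
      atTop (𝓝 (C * (eLpNorm g 2 volume + ((0 : ℝ≥0) : ℝ≥0∞)))) := by
    refine ENNReal.Tendsto.const_mul (tendsto_const_nhds.add ?_) (Or.inr ENNReal.coe_ne_top)
    exact ENNReal.tendsto_coe.2 tendsto_one_div_add_atTop_nhds_zero_nat
  rw [ENNReal.coe_zero, add_zero] at ht
  exact ge_of_tendsto' ht fun k => hη _ (by positivity)

/-! ### The pointwise bound for radial functions -/

/-- Two vectors of equal norm are exchanged by a reflection. -/
theorem eq_of_norm_eq_of_comp_isometry {w : E N → ℝ}
    (hw : ∀ (S : E N ≃ₗᵢ[ℝ] E N) x, w (S x) = w x) {x y : E N} (h : ‖x‖ = ‖y‖) : w x = w y := by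
  rw [← hw (Submodule.reflection (Submodule.span ℝ {x - y})ᗮ) x, Submodule.reflection_sub h]

theorem abs_deriv_radial_le {w : E N → ℝ} (hw : ContDiff ℝ 1 w)
    (hr : ∀ x y, ‖x‖ = ‖y‖ → w x = w y) {e : E N} (he : ‖e‖ = 1) {x : E N} (hx : x ≠ 0) :
    |deriv (fun s : ℝ => w (s • e)) ‖x‖| ≤ ‖fderiv ℝ w x‖ := by
  have hx0 : ‖x‖ ≠ 0 := norm_ne_zero_iff.2 hx
  set d : E N := ‖x‖⁻¹ • x with hd
  have hd1 : ‖d‖ = 1 := by rw [hd, norm_smul, norm_inv, norm_norm, inv_mul_cancel₀ hx0]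
  have hxd : ‖x‖ • d = x := by rw [hd, smul_smul, mul_inv_cancel₀ hx0, one_smul]
  have h1 : (fun s : ℝ => w (s • e)) = fun s : ℝ => w (s • d) := by
    ext s
    exact hr _ _ (by rw [norm_smul, norm_smul, he, hd1])
  have h2 : HasDerivAt (fun s : ℝ => w (s • d)) (fderiv ℝ w x d) ‖x‖ := by
    have h3 : HasFDerivAt w (fderiv ℝ w x) (‖x‖ • d) := by
      rw [hxd]
      exact (hw.differentiable (by simp) x).hasFDerivAt
    have h4 : HasDerivAt (fun s : ℝ => s • d) d ‖x‖ := by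
      simpa using (hasDerivAt_id ‖x‖).smul_const d
    exact h3.comp_hasDerivAt _ h4
  rw [h1, h2.deriv]
  simpa [hd1] using (fderiv ℝ w x).le_opNorm d

/-- Since `a > 0`, `(s^a h²)' ≥ 2 s^a h h'`; this is integrated from `r` to a zero `T` of `h`. -/
theorem rpow_mul_sq_le_integral {h : ℝ → ℝ} (hh : ContDiff ℝ 1 h) {a r T : ℝ} (ha : 0 < a)
    (hr : 0 < r) (hrT : r ≤ T) (hT : h T = 0) :
    r ^ a * h r ^ 2 ≤ ∫ s in Ioc r T, s ^ a * (2 * (|h s| * |deriv h s|)) := by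
  have hpos : ∀ s ∈ uIcc r T, 0 < s := fun s hs => by
    rw [uIcc_of_le hrT] at hs
    exact hr.trans_le hs.1
  have hc1 : Continuous (deriv h) := hh.continuous_deriv (by simp)
  have hder : ∀ s ∈ uIcc r T, HasDerivAt (fun s => s ^ a * h s ^ 2)
      (a * s ^ (a - 1) * h s ^ 2 + s ^ a * (2 * (h s * deriv h s))) s := by
    intro s hs
    have h1 := Real.hasDerivAt_rpow_const (p := a) (Or.inl (hpos s hs).ne')
    have h2 := (hh.differentiable (by simp) s).hasDerivAt
    refine (h1.mul (h2.pow 2)).congr_deriv ?_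
    simp only [Nat.cast_ofNat, Pi.pow_apply]
    ring
  have hcr : ∀ b : ℝ, ContinuousOn (fun s : ℝ => s ^ b) (uIcc r T) := fun b s hs =>
    (Real.continuousAt_rpow_const _ _ (Or.inl (hpos s hs).ne')).continuousWithinAt
  have hint := intervalIntegral.integral_eq_sub_of_hasDerivAt hder
    (ContinuousOn.intervalIntegrable (((continuousOn_const.mul (hcr _)).mul
      (hh.continuous.pow 2).continuousOn).add ((hcr _).mul
        (continuous_const.mul (hh.continuous.mul hc1)).continuousOn)))
  rw [hT] at hint
  have : r ^ a * h r ^ 2 = ∫ s in r..T,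
      -(a * s ^ (a - 1) * h s ^ 2 + s ^ a * (2 * (h s * deriv h s))) := by
    rw [intervalIntegral.integral_neg, hint]
    ring
  rw [this, ← intervalIntegral.integral_of_le hrT]
  refine intervalIntegral.integral_mono_on hrT ?_ ?_ fun s hs => ?_
  · exact (ContinuousOn.intervalIntegrable (((continuousOn_const.mul (hcr _)).mul
      (hh.continuous.pow 2).continuousOn).add ((hcr _).mul
        (continuous_const.mul (hh.continuous.mul hc1)).continuousOn))).neg
  · exact ContinuousOn.intervalIntegrable ((hcr _).mul
      (continuous_const.mul (hh.continuous.abs.mul hc1.abs)).continuousOn)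
  · have hs0 : 0 < s := hr.trans_le hs.1
    have h1 : 0 ≤ a * s ^ (a - 1) * h s ^ 2 := by positivity
    have h2 : -(h s * deriv h s) ≤ |h s| * |deriv h s| := by
      rw [← abs_mul]; exact neg_le_abs _
    have h3 : 0 ≤ s ^ a := by positivity
    nlinarith [mul_le_mul_of_nonneg_left h2 h3]

/-- The weight `|y|^{-α}` with values in `[0, ∞]`. At the origin it takes the value of `0 ^ (-α)`
in `ℝ`, which is immaterial because a point is a null set. -/
noncomputable def weight (α : ℝ) (y : E N) : ℝ≥0∞ := ENNReal.ofReal (‖y‖ ^ (-α))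

theorem measurable_weight (α : ℝ) : Measurable (weight α : E N → ℝ≥0∞) :=
  (measurable_norm.pow_const _).ennreal_ofReal

theorem two_mul_ofReal (s : ℝ) : (2 : ℝ≥0∞) * ENNReal.ofReal s = ENNReal.ofReal (2 * s) := by
  rw [ENNReal.ofReal_mul (by norm_num), ENNReal.ofReal_ofNat]

/-- The bound `|x|^a w(x)² ≤ C ‖∇w‖_2 ‖|y|^{-α/2} w‖_2`, `a = N - 1 - α / 2`, for
compactly supported radial `w` of class `C¹`.
The weighted norm is restricted to `|y| > |x|`, where the weight varies slowly; this is what makes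
the bound stable under mollification. -/
theorem exists_radial_bound_smooth (hN : 1 ≤ N) {α : ℝ} (hα : α < 2 * (N : ℝ) - 2) :
    ∃ C : ℝ≥0, ∀ w : E N → ℝ, ContDiff ℝ 1 w → HasCompactSupport w →
      (∀ x y, ‖x‖ = ‖y‖ → w x = w y) → ∀ x : E N, x ≠ 0 →
      ENNReal.ofReal (‖x‖ ^ ((N : ℝ) - 1 - α / 2) * w x ^ 2) ≤
        C * ((∫⁻ y, ‖fderiv ℝ w y‖ₑ ^ 2) ^ (1 / 2 : ℝ) *
          (∫⁻ y, {y : E N | ‖x‖ < ‖y‖}.indicator (weight α) y * ‖w y‖ₑ ^ 2) ^ (1 / 2 : ℝ)) := by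
  have : NeZero N := ⟨by omega⟩
  have : Nontrivial (E N) := by
    rw [← Module.finrank_pos_iff (R := ℝ)]
    simp; omega
  set c : ℝ := N * volume.real (Metric.ball (0 : E N) 1) with hc
  have hc0 : 0 < c := by
    have : 0 < volume.real (Metric.ball (0 : E N) 1) :=
      ENNReal.toReal_pos (Metric.measure_ball_pos _ _ (by norm_num)).ne' measure_ball_lt_top.ne
    have : (0:ℝ) < N := by exact_mod_cast hN
    positivity
  refine ⟨(2 * c⁻¹).toNNReal, fun w hw hcs hrad x hx => ?_⟩
  set e : E N := EuclideanSpace.single 0 1 with he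
  have he1 : ‖e‖ = 1 := by simp [he]
  set a : ℝ := (N : ℝ) - 1 - α / 2 with ha
  have ha0 : 0 < a := by rw [ha]; linarith
  set h : ℝ → ℝ := fun s => w (s • e) with hh
  have hhC : ContDiff ℝ 1 h := hw.comp (contDiff_id.smul contDiff_const)
  have hwh : ∀ y, w y = h ‖y‖ := fun y => hrad _ _ (by rw [norm_smul, he1]; simp)
  set r : ℝ := ‖x‖ with hr
  have hr0 : 0 < r := norm_pos_iff.2 hx
  obtain ⟨T, hrT, hT⟩ : ∃ T, r ≤ T ∧ h T = 0 := by
    obtain ⟨R, hR⟩ := hcs.isCompact.isBounded.subset_closedBall (0 : E N)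
    refine ⟨max r (R + 1), le_max_left _ _, ?_⟩
    by_contra hne
    have := hR (subset_closure (Function.mem_support.2 hne))
    rw [mem_closedBall_zero_iff, norm_smul, he1, mul_one, Real.norm_of_nonneg
      (hr0.le.trans (le_max_left _ _))] at this
    have := (le_max_right r (R + 1)).trans this
    linarith
  have key := rpow_mul_sq_le_integral hhC ha0 hr0 hrT hT
  -- The integrand of `key` is `s ^ (N - 1) * f s`, the radial density of `y ↦ f ‖y‖`.
  set f : ℝ → ℝ := (Ioc r T).indicator fun s => s ^ (-α / 2) * (2 * (|h s| * |deriv h s|)) with hf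
  have hcd : Continuous (deriv h) := hhC.continuous_deriv (by simp)
  have hf0 : ∀ s, 0 ≤ f s := fun s => indicator_nonneg (fun s hs => by
    have : 0 < s := hr0.trans hs.1
    positivity) s
  have hfeq : ∀ s, s ^ (Module.finrank ℝ (E N) - 1) • f s =
      (Ioc r T).indicator (fun s => s ^ a * (2 * (|h s| * |deriv h s|))) s := by
    intro s
    by_cases hs : s ∈ Ioc r T
    · have hs0 : 0 < s := hr0.trans hs.1
      rw [hf, indicator_of_mem hs, indicator_of_mem hs, finrank_euclideanSpace_fin, smul_eq_mul,
        ← mul_assoc, ← Real.rpow_natCast, ← Real.rpow_add hs0, Nat.cast_sub hN]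
      congr 2
      rw [ha]; push_cast; ring
    · rw [hf, indicator_of_notMem hs, indicator_of_notMem hs, smul_zero]
  have hfint : Integrable (fun y : E N => f ‖y‖) := by
    rw [integrable_fun_norm_addHaar]
    simp only [hfeq]
    rw [IntegrableOn, integrable_indicator_iff measurableSet_Ioc]
    refine IntegrableOn.restrict ?_
    refine (ContinuousOn.integrableOn_compact isCompact_Icc ?_).mono_set Ioc_subset_Icc_self
    refine ContinuousOn.mul (fun s hs => ?_)
      (continuous_const.mul (hhC.continuous.abs.mul hcd.abs)).continuousOn
    exact (Real.continuousAt_rpow_const _ _ (Or.inl (hr0.trans_le hs.1).ne')).continuousWithinAt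
  have hpolar : ∫ y : E N, f ‖y‖ = c * ∫ s in Ioc r T, s ^ a * (2 * (|h s| * |deriv h s|)) := by
    rw [integral_fun_norm_addHaar]
    simp only [hfeq]
    rw [setIntegral_indicator measurableSet_Ioc, inter_eq_self_of_subset_right
      (Ioc_subset_Ioi_self.trans (Ioi_subset_Ioi hr0.le)), finrank_euclideanSpace_fin,
      nsmul_eq_mul, smul_eq_mul, hc, mul_assoc]
  have h1 : r ^ a * w x ^ 2 ≤ c⁻¹ * ∫ y : E N, f ‖y‖ := by
    rw [hpolar, ← mul_assoc, inv_mul_cancel₀ hc0.ne', one_mul, hwh x]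
    exact key
  have hpt : ∀ y : E N, ENNReal.ofReal (f ‖y‖) ≤ 2 * ((‖fderiv ℝ w y‖ₑ ^ 2) ^ (1 / 2 : ℝ) *
      ({y : E N | r < ‖y‖}.indicator (weight α) y * ‖w y‖ₑ ^ 2) ^ (1 / 2 : ℝ)) := by
    intro y
    by_cases hy : ‖y‖ ∈ Ioc r T
    · have hy0 : 0 < ‖y‖ := hr0.trans hy.1
      rw [hf, indicator_of_mem hy, indicator_of_mem (show y ∈ {y : E N | r < ‖y‖} from hy.1),
        ENNReal.mul_rpow_of_nonneg _ _ (by norm_num), ← ENNReal.rpow_natCast_mul,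
        ← ENNReal.rpow_natCast_mul, weight, ENNReal.ofReal_rpow_of_nonneg (by positivity)
        (by norm_num), ← Real.rpow_mul hy0.le]
      norm_num
      rw [← ofReal_norm, ← ofReal_norm, ← ENNReal.ofReal_mul (by positivity),
        ← ENNReal.ofReal_mul (by positivity), two_mul_ofReal]
      refine ENNReal.ofReal_le_ofReal ?_
      have hd := abs_deriv_radial_le hw hrad he1 (norm_pos_iff.1 hy0)
      rw [hwh y, Real.norm_eq_abs, show -α / 2 = -(α * (1 / 2)) by ring]
      calc ‖y‖ ^ (-(α * (1 / 2))) * (2 * (|h ‖y‖| * |deriv h ‖y‖|))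
          ≤ ‖y‖ ^ (-(α * (1 / 2))) * (2 * (|h ‖y‖| * ‖fderiv ℝ w y‖)) := by gcongr
        _ = _ := by ring
    · rw [hf, indicator_of_notMem hy]
      simp
  have hmw : Measurable fun y : E N => {y : E N | r < ‖y‖}.indicator (weight α) y :=
    (measurable_weight α).indicator (measurableSet_lt measurable_const measurable_norm)
  calc ENNReal.ofReal (r ^ a * w x ^ 2) ≤ ENNReal.ofReal (c⁻¹ * ∫ y : E N, f ‖y‖) :=
        ENNReal.ofReal_le_ofReal h1
    _ = ENNReal.ofReal c⁻¹ * ∫⁻ y : E N, ENNReal.ofReal (f ‖y‖) := by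
        rw [ENNReal.ofReal_mul (by positivity), ofReal_integral_eq_lintegral_ofReal hfint
          (ae_of_all _ fun y => hf0 _)]
    _ ≤ ENNReal.ofReal c⁻¹ * ∫⁻ y : E N, 2 * ((‖fderiv ℝ w y‖ₑ ^ 2) ^ (1 / 2 : ℝ) *
          ({y : E N | r < ‖y‖}.indicator (weight α) y * ‖w y‖ₑ ^ 2) ^ (1 / 2 : ℝ)) := by
        gcongr with y
        exact hpt y
    _ = (2 * c⁻¹).toNNReal * ∫⁻ y : E N, ((‖fderiv ℝ w y‖ₑ ^ 2) ^ (1 / 2 : ℝ) *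
          ({y : E N | r < ‖y‖}.indicator (weight α) y * ‖w y‖ₑ ^ 2) ^ (1 / 2 : ℝ)) := by
        rw [lintegral_const_mul' _ _ (by norm_num), ← mul_assoc, mul_comm _ (2 : ℝ≥0∞),
          two_mul_ofReal]
        rfl
    _ ≤ _ := by
        gcongr
        exact ENNReal.lintegral_mul_norm_pow_le
          ((hw.continuous_fderiv (by simp)).enorm.measurable.pow_const 2).aemeasurable
          (hmw.mul (hw.continuous.enorm.measurable.pow_const 2)).aemeasurable
          (by norm_num) (by norm_num) (by norm_num)

theorem ae_ne_zero (hN : 1 ≤ N) : ∀ᵐ x : E N, x ≠ 0 := by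
  have : Nontrivial (E N) := by
    rw [← Module.finrank_pos_iff (R := ℝ)]
    simp; omega
  rw [ae_iff]
  simp

theorem weight_le_of_norm_sub_le {α ε : ℝ} (hα : 0 < α) {x y t : E N} (hx : x ≠ 0)
    (ht : t ≠ 0) (h : ‖y - t‖ ≤ ε) :
    {y : E N | ‖x‖ < ‖y‖}.indicator (weight α) y ≤
      ENNReal.ofReal ((1 + ε / ‖x‖) ^ α) * weight α t := by
  by_cases hy : ‖x‖ < ‖y‖
  · have hε : 0 ≤ ε := (norm_nonneg _).trans h
    have hx0 : 0 < ‖x‖ := norm_pos_iff.2 hx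
    have hy0 : 0 < ‖y‖ := hx0.trans hy
    have ht0 : 0 < ‖t‖ := norm_pos_iff.2 ht
    rw [indicator_of_mem (show y ∈ {y : E N | ‖x‖ < ‖y‖} from hy), weight, weight,
      ← ENNReal.ofReal_mul (by positivity)]
    refine ENNReal.ofReal_le_ofReal ?_
    rw [Real.rpow_neg hy0.le, Real.rpow_neg ht0.le, ← div_eq_mul_inv, ← Real.div_rpow
      (by positivity) ht0.le, ← Real.inv_rpow hy0.le]
    refine Real.rpow_le_rpow (by positivity) ?_ hα.le
    rw [le_div_iff₀ ht0, inv_mul_le_iff₀ hy0]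
    have h1 : ‖t‖ ≤ ‖y‖ + ε := by
      have := norm_sub_norm_le t y
      rw [norm_sub_rev] at this
      linarith
    have h2 : ε ≤ ‖y‖ * (ε / ‖x‖) := by
      rw [mul_div_assoc', le_div_iff₀ hx0, mul_comm]
      gcongr
    linarith
  · rw [indicator_of_notMem (show y ∉ {y : E N | ‖x‖ < ‖y‖} from hy)]
    exact zero_le

theorem exists_radial_bound_compactSupport (hN : 1 ≤ N) {α : ℝ} (hα0 : 0 < α)
    (hα : α < 2 * (N : ℝ) - 2) :
    ∃ C : ℝ≥0, ∀ (v : E N → ℝ) (g : E N → E N), HasCompactSupport v → IsRadial v →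
      IsWeakGradient v g → MemLp g 2 volume → ∀ᵐ x : E N,
      ENNReal.ofReal (‖x‖ ^ ((N : ℝ) - 1 - α / 2) * v x ^ 2) ≤
        C * (eLpNorm g 2 volume * (∫⁻ y, weight α y * ‖v y‖ₑ ^ 2) ^ (1 / 2 : ℝ)) := by
  obtain ⟨C, hC⟩ := exists_radial_bound_smooth hN hα
  refine ⟨C, fun v g hcs hrad hg hg2 => ?_⟩
  obtain ⟨φ, ε, hφ, hε, hε0, hlim⟩ := exists_mollifier_seq N
  have hne := ae_ne_zero hN
  filter_upwards [hlim v hg.1, hne] with x hx hx0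
  have hx0' : 0 < ‖x‖ := norm_pos_iff.2 hx0
  have hle : ∀ n, ENNReal.ofReal (‖x‖ ^ ((N : ℝ) - 1 - α / 2) * mollify (φ n) v x ^ 2) ≤
      C * (eLpNorm g 2 volume * (ENNReal.ofReal ((1 + ε n / ‖x‖) ^ α) *
        ∫⁻ y, weight α y * ‖v y‖ₑ ^ 2) ^ (1 / 2 : ℝ)) := by
    intro n
    refine (hC (mollify (φ n) v) ((contDiff_mollify (hφ n) hg.1).of_le (by simp))
      (hasCompactSupport_mollify (hφ n) hcs)
      (fun x y h => eq_of_norm_eq_of_comp_isometry (mollify_comp_isometry (hφ n) hrad) h)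
      x hx0).trans ?_
    have h1 : (∫⁻ y, ‖fderiv ℝ (mollify (φ n) v) y‖ₑ ^ 2) ^ (1 / 2 : ℝ) ≤ eLpNorm g 2 volume := by
      rw [eLpNorm_two_sq]
      simp only [enorm_fderiv_mollify (hφ n) hg]
      exact ENNReal.rpow_le_rpow (lintegral_enorm_mollify_sq_le (hφ n) hg.2.1) (by norm_num)
    have h2 : ∫⁻ y, {y : E N | ‖x‖ < ‖y‖}.indicator (weight α) y * ‖mollify (φ n) v y‖ₑ ^ 2 ≤
        ENNReal.ofReal ((1 + ε n / ‖x‖) ^ α) * ∫⁻ y, weight α y * ‖v y‖ₑ ^ 2 := by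
      refine (lintegral_mul_enorm_mollify_sq_le (hφ n) hg.1
        (V := fun t => ENNReal.ofReal ((1 + ε n / ‖x‖) ^ α) * weight α t)
        ((measurable_weight α).const_mul _) fun y => ?_).trans_eq ?_
      · filter_upwards [hne] with t ht h
        exact weight_le_of_norm_sub_le hα0 hx0 ht h
      · simp only [mul_assoc]
        rw [lintegral_const_mul' _ _ ENNReal.ofReal_ne_top]
    gcongr
  have ht1 : Tendsto (fun n => ENNReal.ofReal (‖x‖ ^ ((N : ℝ) - 1 - α / 2) *
      mollify (φ n) v x ^ 2)) atTop
      (𝓝 (ENNReal.ofReal (‖x‖ ^ ((N : ℝ) - 1 - α / 2) * v x ^ 2))) :=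
    ENNReal.tendsto_ofReal ((hx.pow 2).const_mul _)
  have ht2 : Tendsto (fun n => ENNReal.ofReal ((1 + ε n / ‖x‖) ^ α)) atTop (𝓝 1) := by
    have h1 : Tendsto (fun n => 1 + ε n / ‖x‖) atTop (𝓝 (1 + 0 / ‖x‖)) :=
      tendsto_const_nhds.add (hε0.div_const _)
    have h2 := (h1.rpow_const (p := α) (Or.inr hα0.le))
    simpa using ENNReal.tendsto_ofReal h2
  have ht3 := ENNReal.Tendsto.mul_const (b := ∫⁻ y, weight α y * ‖v y‖ₑ ^ 2) ht2
    (Or.inl one_ne_zero)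
  have ht4 := ((ENNReal.continuous_rpow_const (y := (1 / 2 : ℝ))).tendsto _).comp ht3
  have ht5 := ENNReal.Tendsto.const_mul (a := (C : ℝ≥0∞))
    (ENNReal.Tendsto.const_mul (a := eLpNorm g 2 volume) ht4 (Or.inr hg2.2.ne))
    (Or.inr ENNReal.coe_ne_top)
  rw [one_mul] at ht5
  exact le_of_tendsto_of_tendsto' ht1 ht5 hle

/-- The radial bound for `u` in `D^{1,2}`: since `χ_n u = u` on the ball of radius `n`, it is
inherited from the cutoffs of `u`. -/
theorem exists_radial_bound (hN : 3 ≤ N) {α : ℝ} (hα0 : 0 < α) (hα : α < 2 * (N : ℝ) - 2) :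
    ∃ C : ℝ≥0, ∀ (u : E N → ℝ) (g : E N → E N),
      MemLp u (ENNReal.ofReal (twoStar N)) volume → IsWeakGradient u g → MemLp g 2 volume →
      IsRadial u → (∫⁻ y, weight α y * ‖u y‖ₑ ^ 2) ≠ ⊤ → ∀ᵐ x : E N,
      ENNReal.ofReal (‖x‖ ^ ((N : ℝ) - 1 - α / 2) * u x ^ 2) ≤
        C * (eLpNorm g 2 volume * (∫⁻ y, weight α y * ‖u y‖ₑ ^ 2) ^ (1 / 2 : ℝ)) := by
  obtain ⟨C, hC⟩ := exists_radial_bound_compactSupport (by omega) hα0 hα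
  refine ⟨C, fun u g hu hg hg2 hrad hQ => ?_⟩
  obtain ⟨χ, G, hχ, h0, h1, hχ1, hcs, hχr, hG, hle⟩ := exists_cutoff_approx hN hu hg hg2
  have hall : ∀ k : ℕ, ∀ᵐ x : E N,
      ENNReal.ofReal (‖x‖ ^ ((N : ℝ) - 1 - α / 2) * u x ^ 2) ≤
        C * ((eLpNorm g 2 volume + ((1 / ((k : ℝ≥0) + 1) : ℝ≥0) : ℝ≥0∞)) *
          (∫⁻ y, weight α y * ‖u y‖ₑ ^ 2) ^ (1 / 2 : ℝ)) := by
    intro k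
    obtain ⟨n₀, hn₀⟩ := eventually_atTop.1 (hle (1 / ((k : ℝ≥0) + 1)) (by positivity))
    have hn : ∀ n : ℕ, ∀ᵐ x : E N, n₀ ≤ n →
        ENNReal.ofReal (‖x‖ ^ ((N : ℝ) - 1 - α / 2) * (χ n x * u x) ^ 2) ≤
        C * ((eLpNorm g 2 volume + ((1 / ((k : ℝ≥0) + 1) : ℝ≥0) : ℝ≥0∞)) *
          (∫⁻ y, weight α y * ‖u y‖ₑ ^ 2) ^ (1 / 2 : ℝ)) := by
      intro n
      by_cases hnn : n₀ ≤ n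
      swap
      · exact ae_of_all _ fun x h => absurd h hnn
      have hG2 : MemLp (G n) 2 volume := ⟨(hG n).2.1.aestronglyMeasurable,
        (hn₀ n hnn).trans_lt (ENNReal.add_lt_top.2 ⟨hg2.2, ENNReal.coe_lt_top⟩)⟩
      have hr : IsRadial (fun x => χ n x * u x) := fun S => by
        filter_upwards [hrad S] with x hx
        rw [hx, hχr n (S x) x (S.norm_map x)]
      filter_upwards [hC _ _ (hcs n).mul_right hr (hG n) hG2] with x hx _
      refine hx.trans ?_
      gcongr with y
      · exact hn₀ n hnn
      · rw [Pi.mul_apply, enorm_mul, Real.enorm_of_nonneg (h0 n y)]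
        exact mul_le_of_le_one_left zero_le (ENNReal.ofReal_le_one.2 (h1 n y))
    filter_upwards [ae_all_iff.2 hn] with x hx
    have := hx (max n₀ ⌈‖x‖⌉₊) (le_max_left _ _)
    rwa [hχ1 _ x ((Nat.le_ceil _).trans (by exact_mod_cast le_max_right _ _)), one_mul] at this
  filter_upwards [ae_all_iff.2 hall] with x hx
  have h1 : Tendsto (fun k : ℕ => eLpNorm g 2 volume + ((1 / ((k : ℝ≥0) + 1) : ℝ≥0) : ℝ≥0∞))
      atTop (𝓝 (eLpNorm g 2 volume + ((0 : ℝ≥0) : ℝ≥0∞))) :=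
    tendsto_const_nhds.add (ENNReal.tendsto_coe.2 tendsto_one_div_add_atTop_nhds_zero_nat)
  rw [ENNReal.coe_zero, add_zero] at h1
  have h2 := ENNReal.Tendsto.const_mul (a := (C : ℝ≥0∞)) (ENNReal.Tendsto.mul_const
    (b := (∫⁻ y, weight α y * ‖u y‖ₑ ^ 2) ^ (1 / 2 : ℝ)) h1
    (Or.inr (ENNReal.rpow_ne_top_of_nonneg (by norm_num) hQ))) (Or.inr ENNReal.coe_ne_top)
  exact ge_of_tendsto' h2 hx

/-! ### Embeddings of the radial space -/

theorem MemD12.isWeakGradient {u : E N → ℝ} (hu : MemD12 u) :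
    IsWeakGradient u (weakGradient u) := by
  have h : ∃ g, IsWeakGradient u g := ⟨_, hu.2.choose_spec.1⟩
  rw [weakGradient, dif_pos h]
  exact h.choose_spec

theorem MemD12.memLp_weakGradient {u : E N → ℝ} (hu : MemD12 u) :
    MemLp (weakGradient u) 2 volume := by
  obtain ⟨-, g, hg, hg2⟩ := hu
  exact hg2.ae_eq hg.weakGradient_ae_eq.symm

theorem integrable_normSqA {α A : ℝ} {u : E N → ℝ} (hu : MemH α u) :
    Integrable (fun x => ‖weakGradient u x‖ ^ 2 + A / ‖x‖ ^ α * u x ^ 2) volume := by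
  refine Integrable.add ?_ ?_
  · exact hu.1.memLp_weakGradient.integrable_norm_pow (by norm_num)
  · refine (hu.2.const_mul A).congr (ae_of_all _ fun x => ?_)
    simp only
    ring

theorem weight_mul_enorm_sq (α : ℝ) (u : E N → ℝ) (x : E N) :
    weight α x * ‖u x‖ₑ ^ 2 = ENNReal.ofReal (u x ^ 2 / ‖x‖ ^ α) := by
  rw [weight, ← ofReal_norm, ← ENNReal.ofReal_pow (norm_nonneg _),
    ← ENNReal.ofReal_mul (by positivity), Real.norm_eq_abs, sq_abs, Real.rpow_neg (norm_nonneg _),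
    div_eq_inv_mul]

theorem lintegral_gradient_le {α A : ℝ} (hA : 0 < A) {u : E N → ℝ} (hu : MemH α u) :
    ∫⁻ x, ‖weakGradient u x‖ₑ ^ 2 ≤ ENNReal.ofReal (normSqA α A u) := by
  rw [normSqA, ofReal_integral_eq_lintegral_ofReal (integrable_normSqA hu)
    (ae_of_all _ fun x => by positivity)]
  refine lintegral_mono fun x => ?_
  rw [← ofReal_norm, ← ENNReal.ofReal_pow (norm_nonneg _)]
  refine ENNReal.ofReal_le_ofReal ?_
  have : 0 ≤ A / ‖x‖ ^ α * u x ^ 2 := by positivity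
  linarith

theorem lintegral_weight_le {α A : ℝ} (hA : 0 < A) {u : E N → ℝ} (hu : MemH α u) :
    ENNReal.ofReal A * ∫⁻ x, weight α x * ‖u x‖ₑ ^ 2 ≤ ENNReal.ofReal (normSqA α A u) := by
  rw [normSqA, ofReal_integral_eq_lintegral_ofReal (integrable_normSqA hu)
    (ae_of_all _ fun x => by positivity), ← lintegral_const_mul' _ _ ENNReal.ofReal_ne_top]
  refine lintegral_mono fun x => ?_
  rw [weight_mul_enorm_sq, ← ENNReal.ofReal_mul hA.le]
  refine ENNReal.ofReal_le_ofReal ?_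
  have : 0 ≤ ‖weakGradient u x‖ ^ 2 := by positivity
  have h2 : A * (u x ^ 2 / ‖x‖ ^ α) = A / ‖x‖ ^ α * u x ^ 2 := by ring
  linarith

theorem normSqA_pos (hN : 1 ≤ N) {α A : ℝ} (hA : 0 < A) {u : E N → ℝ} (hu : MemH α u)
    (hne : ¬ u =ᵐ[volume] 0) : 0 < normSqA α A u := by
  by_contra! h
  apply hne
  have h1 := lintegral_weight_le hA hu
  rw [ENNReal.ofReal_of_nonpos h, nonpos_iff_eq_zero, mul_eq_zero, ENNReal.ofReal_eq_zero] at h1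
  have h2 := h1.resolve_left (by linarith)
  rw [lintegral_eq_zero_iff' (f := fun x => weight α x * ‖u x‖ₑ ^ 2)
    ((measurable_weight α).aemeasurable.mul (hu.1.1.1.enorm.pow_const 2))] at h2
  filter_upwards [h2, ae_ne_zero hN] with x hx hx0
  have hx0' : 0 < ‖x‖ := norm_pos_iff.2 hx0
  rw [weight, Pi.zero_apply, mul_eq_zero, ENNReal.ofReal_eq_zero] at hx
  have := hx.resolve_left (not_le.2 (by positivity))
  simpa using this

/-- The two endpoint embeddings, into `L^{2^*}` and into `L^{2^*_α}`, with the dependence on `A`. -/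
theorem exists_embedding (hN : 3 ≤ N) {α : ℝ} (hα0 : 0 < α) (hα : α < 2 * (N : ℝ) - 2) :
    ∃ C : ℝ, 0 < C ∧ ∀ A : ℝ, 0 < A → ∀ u : E N → ℝ, MemHr α u → 0 < normSqA α A u →
      ∫⁻ x, ‖u x‖ₑ ^ twoStar N ≤ ENNReal.ofReal (C * normSqA α A u ^ (twoStar N / 2)) ∧
      ∫⁻ x, ‖u x‖ₑ ^ twoStarAlpha N α ≤ ENNReal.ofReal (C *
        A ^ (-((2 * (N : ℝ) - 2) / (2 * (N : ℝ) - 2 - α))) *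
          normSqA α A u ^ (twoStarAlpha N α / 2)) := by
  have h2 := two_lt_twoStar hN
  obtain ⟨C₁, hC₁⟩ := exists_sobolev hN
  obtain ⟨C₂, hC₂⟩ := exists_radial_bound hN hα0 hα
  set a : ℝ := (N : ℝ) - 1 - α / 2 with ha
  have ha0 : 0 < a := by rw [ha]; linarith
  have hNa : 2 * (N : ℝ) - 2 + α = 2 * a + 2 * α := by rw [ha]; ring
  have hNa' : 2 * (N : ℝ) - 2 - α = 2 * a := by rw [ha]; ring
  refine ⟨max ((C₁ + 1 : ℝ) ^ twoStar N) ((C₂ : ℝ) ^ (α / a)), lt_max_of_lt_left (by positivity),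
    fun A hA u hu hX => ?_⟩
  set X := normSqA α A u with hXdef
  set C := max ((C₁ + 1 : ℝ) ^ twoStar N) ((C₂ : ℝ) ^ (α / a))
  have hD := lintegral_gradient_le hA hu.1
  have hQ' := lintegral_weight_le hA hu.1
  rw [← hXdef] at hD hQ'
  have hQ : ∫⁻ x, weight α x * ‖u x‖ₑ ^ 2 ≤ ENNReal.ofReal (X / A) := by
    rw [ENNReal.ofReal_div_of_pos hA, ENNReal.le_div_iff_mul_le
      (Or.inl (by simpa using hA)) (Or.inl ENNReal.ofReal_ne_top), mul_comm]
    exact hQ'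
  have hg := hu.1.1.isWeakGradient
  have hg2 := hu.1.1.memLp_weakGradient
  have hD2 : eLpNorm (weakGradient u) 2 volume ≤ ENNReal.ofReal (X ^ (1 / 2 : ℝ)) := by
    rw [eLpNorm_two_sq, ← ENNReal.ofReal_rpow_of_pos hX]
    exact ENNReal.rpow_le_rpow hD (by norm_num)
  constructor
  · have hs := hC₁ u _ hu.1.1.1 hg hg2
    have hq0 : ENNReal.ofReal (twoStar N) ≠ 0 := by
      rw [Ne, ENNReal.ofReal_eq_zero]; linarith
    have h3 : ∫⁻ x, ‖u x‖ₑ ^ twoStar N =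
        eLpNorm u (ENNReal.ofReal (twoStar N)) volume ^ twoStar N := by
      rw [eLpNorm_eq_lintegral_rpow_enorm_toReal hq0 ENNReal.ofReal_ne_top,
        ENNReal.toReal_ofReal (by linarith), ← ENNReal.rpow_mul, one_div,
        inv_mul_cancel₀ (by linarith), ENNReal.rpow_one]
    have h4 : eLpNorm u (ENNReal.ofReal (twoStar N)) volume ≤
        ENNReal.ofReal ((C₁ + 1) * X ^ (1 / 2 : ℝ)) := by
      rw [ENNReal.ofReal_mul (by positivity)]
      refine hs.trans (mul_le_mul' ?_ hD2)
      rw [← ENNReal.ofReal_coe_nnreal]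
      exact ENNReal.ofReal_le_ofReal (by linarith)
    rw [h3]
    refine (ENNReal.rpow_le_rpow h4 (by linarith)).trans ?_
    rw [ENNReal.ofReal_rpow_of_pos (by positivity)]
    refine ENNReal.ofReal_le_ofReal ?_
    rw [Real.mul_rpow (by positivity) (by positivity), ← Real.rpow_mul hX.le,
      one_div, inv_mul_eq_div]
    exact mul_le_mul_of_nonneg_right (le_max_left _ _) (by positivity)
  · have hrad := hC₂ u _ hu.1.1.1 hg hg2 hu.2 (ne_top_of_le_ne_top ENNReal.ofReal_ne_top hQ)
    set B : ℝ := C₂ * (A ^ (-(1 / 2) : ℝ) * X) with hB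
    have hB0 : 0 ≤ B := by positivity
    have hbound : (C₂ : ℝ≥0∞) * (eLpNorm (weakGradient u) 2 volume *
        (∫⁻ y, weight α y * ‖u y‖ₑ ^ 2) ^ (1 / 2 : ℝ)) ≤ ENNReal.ofReal B := by
      calc (C₂ : ℝ≥0∞) * (eLpNorm (weakGradient u) 2 volume *
          (∫⁻ y, weight α y * ‖u y‖ₑ ^ 2) ^ (1 / 2 : ℝ))
          ≤ ENNReal.ofReal C₂ * (ENNReal.ofReal (X ^ (1 / 2 : ℝ)) *
            ENNReal.ofReal (X / A) ^ (1 / 2 : ℝ)) := by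
            rw [ENNReal.ofReal_coe_nnreal]
            gcongr
        _ = ENNReal.ofReal B := by
            rw [ENNReal.ofReal_rpow_of_pos (by positivity), ← ENNReal.ofReal_mul (by positivity),
              ← ENNReal.ofReal_mul (by positivity), hB]
            congr 2
            rw [Real.div_rpow hX.le hA.le, Real.rpow_neg hA.le, mul_div_assoc',
              ← Real.rpow_add hX]
            norm_num
            ring
    -- `|u|^{2^*_α} = (u²)^{α/a} u²`, and the radial bound is applied to the first factor.
    have hpt : ∀ᵐ x, ‖u x‖ₑ ^ twoStarAlpha N α ≤
        ENNReal.ofReal (B ^ (α / a)) * (weight α x * ‖u x‖ₑ ^ 2) := by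
      filter_upwards [hrad, ae_ne_zero (N := N) (by omega)] with x hx hx0
      have hx0' : 0 < ‖x‖ := norm_pos_iff.2 hx0
      have h5 : ‖x‖ ^ a * u x ^ 2 ≤ B := (ENNReal.ofReal_le_ofReal_iff hB0).1 (hx.trans hbound)
      have h6 : twoStarAlpha N α = 2 * (α / a) + 2 := by
        rw [twoStarAlpha, hNa, hNa']
        field_simp
        ring
      rw [weight_mul_enorm_sq, ← ENNReal.ofReal_mul (by positivity), ← ofReal_norm,
        ENNReal.ofReal_rpow_of_nonneg (norm_nonneg _) (by rw [h6]; positivity)]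
      refine ENNReal.ofReal_le_ofReal ?_
      have h7 : (‖x‖ ^ a * u x ^ 2) ^ (α / a) ≤ B ^ (α / a) :=
        Real.rpow_le_rpow (by positivity) h5 (by positivity)
      have h8 : (‖x‖ ^ a * u x ^ 2) ^ (α / a) = ‖x‖ ^ α * ‖u x‖ ^ (2 * (α / a)) := by
        rw [Real.mul_rpow (by positivity) (by positivity), ← Real.rpow_mul hx0'.le,
          mul_div_cancel₀ _ ha0.ne', ← sq_abs, ← Real.norm_eq_abs, ← Real.rpow_natCast,
          ← Real.rpow_mul (norm_nonneg _)]
        norm_num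
      rw [h8] at h7
      rw [h6, Real.rpow_add_of_nonneg (norm_nonneg _) (by positivity) (by norm_num),
        Real.rpow_two, Real.norm_eq_abs, sq_abs, ← Real.norm_eq_abs]
      rw [← mul_div_assoc (B ^ (α / a)), le_div_iff₀ (by positivity)]
      nlinarith [mul_le_mul_of_nonneg_right h7 (sq_nonneg (u x))]
    refine (lintegral_mono_ae hpt).trans ?_
    rw [lintegral_const_mul' _ _ ENNReal.ofReal_ne_top]
    refine (mul_le_mul' le_rfl hQ).trans ?_
    rw [← ENNReal.ofReal_mul (by positivity)]
    refine ENNReal.ofReal_le_ofReal ?_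
    have h9 : B ^ (α / a) * (X / A) = (C₂ : ℝ) ^ (α / a) *
        A ^ (-((2 * (N : ℝ) - 2) / (2 * (N : ℝ) - 2 - α))) * X ^ (twoStarAlpha N α / 2) := by
      have e1 : -((2 * (N : ℝ) - 2) / (2 * (N : ℝ) - 2 - α)) = -(1 / 2) * (α / a) - 1 := by
        rw [hNa', show 2 * (N : ℝ) - 2 = 2 * a + α by rw [ha]; ring]
        field_simp
        ring
      have e2 : twoStarAlpha N α / 2 = α / a + 1 := by
        rw [twoStarAlpha, hNa, hNa']
        field_simp
        ring
      rw [e1, e2, Real.rpow_add hX, Real.rpow_sub hA, Real.rpow_mul hA.le, hB,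
        Real.mul_rpow (by positivity) (by positivity), Real.mul_rpow (by positivity) hX.le,
        Real.rpow_one, Real.rpow_one]
      ring
    rw [h9]
    gcongr
    exact le_max_right _ _

theorem lintegral_rpow_interpolation {u : E N → ℝ} (hu : AEStronglyMeasurable u volume)
    {p q r t : ℝ} (hq : 0 ≤ q) (hr : 0 ≤ r) (ht0 : 0 ≤ t) (ht1 : t ≤ 1)
    (hp : p = t * q + (1 - t) * r) :
    ∫⁻ x, ‖u x‖ₑ ^ p ≤ (∫⁻ x, ‖u x‖ₑ ^ q) ^ t * (∫⁻ x, ‖u x‖ₑ ^ r) ^ (1 - t) := by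
  refine le_trans (le_of_eq ?_) (ENNReal.lintegral_mul_norm_pow_le (hu.enorm.pow_const q)
    (hu.enorm.pow_const r) ht0 (sub_nonneg.2 ht1) (by ring))
  refine lintegral_congr fun x => ?_
  rw [← ENNReal.rpow_mul, ← ENNReal.rpow_mul, ← ENNReal.rpow_add_of_nonneg _ _ (by positivity)
    (mul_nonneg hr (sub_nonneg.2 ht1)), hp]
  congr 1
  ring

theorem twoStarAlpha_sub_twoStar (hN : 3 ≤ N) {α : ℝ} (hα : α < 2 * (N : ℝ) - 2) :
    twoStarAlpha N α - twoStar N =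
      4 * ((N : ℝ) - 1) * (α - 2) / ((2 * (N : ℝ) - 2 - α) * ((N : ℝ) - 2)) := by
  have : (3:ℝ) ≤ N := by exact_mod_cast hN
  have h1 : 2 * (N : ℝ) - 2 - α ≠ 0 := by linarith
  have h2 : (N : ℝ) - 2 ≠ 0 := by linarith
  rw [twoStarAlpha, twoStar]
  generalize hd : 2 * (N : ℝ) - 2 - α = d at h1
  generalize he : (N : ℝ) - 2 = e at h2
  obtain rfl : α = 2 * (N : ℝ) - 2 - d := by linarith
  field_simp
  rw [← he]
  ring

/-- The embedding into `L^p` for `p` between `2^*` and `2^*_α`. -/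
theorem exists_embedding_between (hN : 3 ≤ N) {α : ℝ} (hα0 : 0 < α) (hα : α < 2 * (N : ℝ) - 2)
    {p t : ℝ} (ht0 : 0 ≤ t) (ht1 : t ≤ 1)
    (hp : p = t * twoStarAlpha N α + (1 - t) * twoStar N) :
    ∃ C : ℝ, 0 < C ∧ ∀ A : ℝ, 0 < A → ∀ u : E N → ℝ, MemHr α u → 0 < normSqA α A u →
      ∫⁻ x, ‖u x‖ₑ ^ p ≤ ENNReal.ofReal (C *
        A ^ (-(t * ((2 * (N : ℝ) - 2) / (2 * (N : ℝ) - 2 - α)))) * normSqA α A u ^ (p / 2)) := by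
  have h2 := two_lt_twoStar hN
  have hq : 0 ≤ twoStarAlpha N α := by
    have : (3:ℝ) ≤ N := by exact_mod_cast hN
    rw [twoStarAlpha]
    exact mul_nonneg (by norm_num) (div_nonneg (by linarith) (by linarith))
  obtain ⟨C, hC0, hC⟩ := exists_embedding hN hα0 hα
  refine ⟨C, hC0, fun A hA u hu hX => ?_⟩
  obtain ⟨h3, h4⟩ := hC A hA u hu hX
  set X := normSqA α A u
  set κ := (2 * (N : ℝ) - 2) / (2 * (N : ℝ) - 2 - α)
  refine (lintegral_rpow_interpolation hu.1.1.1.1 hq (by linarith) ht0 ht1 hp).trans ?_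
  refine (mul_le_mul' (ENNReal.rpow_le_rpow h4 ht0)
    (ENNReal.rpow_le_rpow h3 (sub_nonneg.2 ht1))).trans (le_of_eq ?_)
  rw [ENNReal.ofReal_rpow_of_pos (by positivity), ENNReal.ofReal_rpow_of_pos (by positivity),
    ← ENNReal.ofReal_mul (by positivity)]
  congr 1
  rw [Real.mul_rpow (by positivity) (by positivity), Real.mul_rpow (by positivity) (by positivity),
    Real.mul_rpow (by positivity) (by positivity), ← Real.rpow_mul hA.le, ← Real.rpow_mul hX.le,
    ← Real.rpow_mul hX.le]
  have e1 : C ^ t * C ^ (1 - t) = C := by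
    rw [← Real.rpow_add hC0]; simp
  have e2 : X ^ (twoStarAlpha N α / 2 * t) * X ^ (twoStar N / 2 * (1 - t)) = X ^ (p / 2) := by
    rw [← Real.rpow_add hX, hp]
    congr 1
    ring
  rw [show -κ * t = -(t * κ) by ring]
  calc C ^ t * A ^ (-(t * κ)) * X ^ (twoStarAlpha N α / 2 * t) *
      (C ^ (1 - t) * X ^ (twoStar N / 2 * (1 - t)))
      = (C ^ t * C ^ (1 - t)) * A ^ (-(t * κ)) *
        (X ^ (twoStarAlpha N α / 2 * t) * X ^ (twoStar N / 2 * (1 - t))) := by ring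
    _ = _ := by rw [e1, e2]

/-! ### The energy functional -/

theorem primitive_truncate {f : ℝ → ℝ} {s : ℝ} (hs : 0 ≤ s) :
    primitive (truncate f) s = primitive f s := by
  refine intervalIntegral.integral_congr fun t ht => ?_
  rw [uIcc_of_le hs] at ht
  rw [truncate, if_neg (not_lt.2 ht.1)]

theorem min_rpow_le {t p₁ p₂ p : ℝ} (ht : 0 < t) (h1 : p₁ ≤ p) (h2 : p ≤ p₂) :
    min (t ^ (p₁ - 1)) (t ^ (p₂ - 1)) ≤ t ^ (p - 1) := by
  rcases le_total t 1 with h | h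
  · exact (min_le_right _ _).trans (Real.rpow_le_rpow_of_exponent_ge ht h (by linarith))
  · exact (min_le_left _ _).trans (Real.rpow_le_rpow_of_exponent_le h (by linarith))

theorem exists_abs_primitive_le {f : ℝ → ℝ} {p₁ p₂ : ℝ}
    (hfp : BddAbove ((fun s : ℝ => |f s| / min (s ^ (p₁ - 1)) (s ^ (p₂ - 1))) '' Ioi 0)) {p : ℝ}
    (hp : 1 < p) (h1 : p₁ ≤ p) (h2 : p ≤ p₂) :
    ∃ M : ℝ, 0 < M ∧ ∀ s, 0 ≤ s → |primitive f s| ≤ M * s ^ p := by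
  obtain ⟨M, hM⟩ := hfp
  refine ⟨|M| + 1, by positivity, fun s hs => ?_⟩
  rcases hs.eq_or_lt with rfl | hs0
  · simp [primitive, Real.zero_rpow (by linarith : p ≠ 0)]
  have hb : ∀ t ∈ uIoc 0 s, ‖f t‖ ≤ (|M| + 1) * s ^ (p - 1) := by
    intro t ht
    rw [uIoc_of_le hs] at ht
    have ht0 : 0 < t := ht.1
    have hmin : 0 < min (t ^ (p₁ - 1)) (t ^ (p₂ - 1)) :=
      lt_min (Real.rpow_pos_of_pos ht0 _) (Real.rpow_pos_of_pos ht0 _)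
    have h3 := hM (mem_image_of_mem _ (show t ∈ Ioi 0 from ht0))
    rw [div_le_iff₀ hmin] at h3
    have h4 : min (t ^ (p₁ - 1)) (t ^ (p₂ - 1)) ≤ s ^ (p - 1) :=
      (min_rpow_le ht0 h1 h2).trans (Real.rpow_le_rpow ht0.le ht.2 (by linarith))
    calc ‖f t‖ ≤ M * min (t ^ (p₁ - 1)) (t ^ (p₂ - 1)) := h3
      _ ≤ (|M| + 1) * min (t ^ (p₁ - 1)) (t ^ (p₂ - 1)) := by
        gcongr
        linarith [le_abs_self M]
      _ ≤ _ := by gcongr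
  have := intervalIntegral.norm_integral_le_of_norm_le_const hb
  rw [Real.norm_eq_abs, sub_zero, abs_of_pos hs0] at this
  rw [primitive]
  refine this.trans_eq ?_
  rw [mul_assoc]
  congr 1
  nth_rewrite 2 [← Real.rpow_one s]
  rw [← Real.rpow_add hs0]
  congr 1
  ring

theorem hasDerivAt_primitive {f : ℝ → ℝ} (hf : Continuous f) (s : ℝ) :
    HasDerivAt (primitive f) (f s) s :=
  hf.integral_hasStrictDerivAt 0 s |>.hasDerivAt

theorem continuous_primitive {f : ℝ → ℝ} (hf : Continuous f) : Continuous (primitive f) :=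
  continuous_iff_continuousAt.2 fun s => (hasDerivAt_primitive hf s).continuousAt

/-- The Ambrosetti-Rabinowitz condition `θ F(s) ≤ f(s) s` makes `τ ↦ τ^{-θ} F(τ s)` monotone. -/
theorem rpow_mul_primitive_le {f : ℝ → ℝ} (hf : Continuous f) {θ : ℝ}
    (hθ : ∀ s : ℝ, 0 < s → θ * primitive f s ≤ f s * s) {s t : ℝ} (hs : 0 < s) (ht : 1 ≤ t) :
    t ^ θ * primitive f s ≤ primitive f (t * s) := by
  have hder : ∀ τ : ℝ, 0 < τ → HasDerivAt (fun τ => primitive f (τ * s) * τ ^ (-θ))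
      (f (τ * s) * s * τ ^ (-θ) + primitive f (τ * s) * (-θ * τ ^ (-θ - 1))) τ := by
    intro τ hτ
    have h1 : HasDerivAt (fun τ : ℝ => primitive f (τ * s)) (f (τ * s) * s) τ :=
      HasDerivAt.comp (h₂ := primitive f) (h := fun τ => τ * s) τ
        (hasDerivAt_primitive hf (τ * s)) (hasDerivAt_mul_const s)
    exact h1.mul (Real.hasDerivAt_rpow_const (Or.inl hτ.ne'))
  have hmono : MonotoneOn (fun τ => primitive f (τ * s) * τ ^ (-θ)) (Ioi 0) := by
    refine monotoneOn_of_deriv_nonneg (convex_Ioi 0)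
      (fun τ hτ => (hder τ hτ).continuousAt.continuousWithinAt)
      (fun τ hτ => ?_) fun τ hτ => ?_
    · rw [interior_Ioi] at hτ
      exact (hder τ hτ).differentiableAt.differentiableWithinAt
    · rw [interior_Ioi] at hτ
      have hτ0 : 0 < τ := hτ
      rw [(hder τ hτ).deriv]
      have h1 : τ ^ (-θ) = τ ^ (-θ - 1) * τ := by
        nth_rewrite 3 [← Real.rpow_one τ]
        rw [← Real.rpow_add hτ0]
        congr 1
        ring
      rw [h1]
      have h2 := hθ (τ * s) (by positivity)
      have h3 : 0 ≤ τ ^ (-θ - 1) := by positivity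
      nlinarith [mul_le_mul_of_nonneg_left h2 h3]
  have ht0 : 0 < t := by linarith
  have h := hmono (mem_Ioi.2 one_pos) (mem_Ioi.2 ht0) ht
  simp only [one_mul, Real.one_rpow, mul_one] at h
  rw [Real.rpow_neg ht0.le, ← div_eq_mul_inv, le_div_iff₀ (by positivity)] at h
  linarith

theorem normSqA_const_mul {α A : ℝ} {u : E N → ℝ} (hu : MemH α u) (t : ℝ) :
    normSqA α A (fun x => t * u x) = t ^ 2 * normSqA α A u := by
  have h1 := (hu.1.isWeakGradient.mul_left (χ := fun _ => t) contDiff_const).weakGradient_ae_eq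
  rw [normSqA, normSqA, ← integral_const_mul]
  refine integral_congr_ae ?_
  filter_upwards [h1] with x hx
  have h2 : gradient (fun _ : E N => t) x = 0 := by simp [gradient]
  simp only [hx, h2, smul_zero, add_zero, norm_smul, mul_pow, Real.norm_eq_abs, sq_abs]
  ring

theorem integral_primitive_truncate {f : ℝ → ℝ} {u : E N → ℝ} (hu : 0 ≤ᵐ[volume] u) {t : ℝ}
    (ht : 0 ≤ t) :
    ∫ x, primitive (truncate f) (t * u x) = ∫ x, primitive f (t * u x) := by
  refine integral_congr_ae ?_
  filter_upwards [hu] with x hx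
  exact primitive_truncate (mul_nonneg ht hx)

theorem energy_const_mul {α A : ℝ} {f : ℝ → ℝ} {u : E N → ℝ} (hu : MemH α u)
    (hu0 : 0 ≤ᵐ[volume] u) {t : ℝ} (ht : 0 ≤ t) :
    energy α A f (fun x => t * u x) =
      1 / 2 * (t ^ 2 * normSqA α A u) - ∫ x, primitive f (t * u x) := by
  rw [energy, normSqA_const_mul hu, integral_primitive_truncate hu0 ht]

theorem integrable_primitive {f : ℝ → ℝ} (hf : Continuous f) {u : E N → ℝ}
    (hu : AEStronglyMeasurable u volume) (hu0 : 0 ≤ᵐ[volume] u) {M p : ℝ}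
    (hM : ∀ s, 0 ≤ s → |primitive f s| ≤ M * s ^ p)
    (hup : Integrable (fun x => ‖u x‖ ^ p) volume) {t : ℝ} (ht : 0 ≤ t) :
    Integrable (fun x => primitive f (t * u x)) volume := by
  refine (hup.const_mul (M * t ^ p)).mono'
    ((continuous_primitive hf).comp_aestronglyMeasurable (hu.const_mul t)) ?_
  filter_upwards [hu0] with x hx
  refine (hM _ (mul_nonneg ht hx)).trans_eq ?_
  rw [Real.mul_rpow ht hx, Real.norm_of_nonneg hx]
  ring

theorem integral_primitive_le {f : ℝ → ℝ} (hf : Continuous f) {u : E N → ℝ}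
    (hu : AEStronglyMeasurable u volume) (hu0 : 0 ≤ᵐ[volume] u) {M p : ℝ}
    (hM : ∀ s, 0 ≤ s → |primitive f s| ≤ M * s ^ p)
    (hup : Integrable (fun x => ‖u x‖ ^ p) volume) {t : ℝ} (ht : 0 ≤ t) :
    ∫ x, primitive f (t * u x) ≤ M * t ^ p * ∫ x, ‖u x‖ ^ p := by
  rw [← integral_const_mul]
  refine integral_mono_ae (integrable_primitive hf hu hu0 hM hup ht) (hup.const_mul _) ?_
  filter_upwards [hu0] with x hx
  refine (le_abs_self _).trans ((hM _ (mul_nonneg ht hx)).trans_eq ?_)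
  rw [Real.mul_rpow ht hx, Real.norm_of_nonneg hx]
  ring

theorem bddAbove_sq_sub_rpow {X c θ : ℝ} (hX : 0 ≤ X) (hc : 0 < c) (hθ : 2 < θ) :
    ∃ B, ∀ t, 1 ≤ t → t ^ 2 * X - t ^ θ * c ≤ B := by
  set T : ℝ := (X / c) ^ (θ - 2)⁻¹ with hT
  have hT0 : 0 ≤ T := by positivity
  refine ⟨T ^ 2 * X, fun t ht => ?_⟩
  have ht0 : 0 < t := by linarith
  rcases le_total t T with h | h
  · have h1 : t ^ 2 * X ≤ T ^ 2 * X := by gcongr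
    have h2 : 0 ≤ t ^ θ * c := by positivity
    linarith
  · have h1 : X / c ≤ t ^ (θ - 2) := by
      have := Real.rpow_le_rpow hT0 h (by linarith : 0 ≤ θ - 2)
      rwa [hT, ← Real.rpow_mul (by positivity), inv_mul_cancel₀ (by linarith),
        Real.rpow_one] at this
    have h2 : t ^ θ = t ^ 2 * t ^ (θ - 2) := by
      rw [← Real.rpow_two, ← Real.rpow_add ht0]
      congr 1; ring
    rw [div_le_iff₀ hc] at h1
    have h3 : t ^ 2 * X ≤ t ^ 2 * (t ^ (θ - 2) * c) := by gcongr
    have h4 : 0 ≤ T ^ 2 * X := by positivity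
    rw [h2]
    nlinarith

theorem bddAbove_energy {α A : ℝ} {f : ℝ → ℝ} (hf : Continuous f)
    (hf1 : ∃ θ : ℝ, 2 < θ ∧ ∀ s : ℝ, 0 < s → θ * primitive f s ≤ f s * s)
    (hf2 : ∀ s : ℝ, 0 < s → 0 < primitive f s) {u : E N → ℝ} (hu : MemH α u)
    (hu0 : 0 ≤ᵐ[volume] u) (hne : ¬ u =ᵐ[volume] 0) {M p : ℝ}
    (hM : ∀ s, 0 ≤ s → |primitive f s| ≤ M * s ^ p)
    (hup : Integrable (fun x => ‖u x‖ ^ p) volume) (hX : 0 ≤ normSqA α A u) :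
    BddAbove ((fun t : ℝ => energy α A f (fun x => t * u x)) '' Ici 0) := by
  obtain ⟨θ, hθ, hθ'⟩ := hf1
  have hF0 : ∀ s, 0 ≤ s → 0 ≤ primitive f s := fun s hs => by
    rcases hs.eq_or_lt with rfl | h
    · simp [primitive]
    · exact (hf2 s h).le
  have hint1 : ∀ t, 0 ≤ t → Integrable (fun x => primitive f (t * u x)) volume := fun t ht =>
    integrable_primitive hf hu.1.1.1 hu0 hM hup ht
  set c := ∫ x, primitive f (u x) with hc
  have hi : Integrable (fun x => primitive f (u x)) volume := by simpa using hint1 1 zero_le_one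
  have hnn : 0 ≤ᵐ[volume] fun x => primitive f (u x) := by
    filter_upwards [hu0] with x hx using hF0 _ hx
  have hc0 : 0 < c := by
    refine lt_of_le_of_ne (integral_nonneg_of_ae hnn) fun h => hne ?_
    have := (integral_eq_zero_iff_of_nonneg_ae hnn hi).1 h.symm
    filter_upwards [this, hu0] with x hx hx0
    by_contra hxne
    exact (hf2 (u x) (lt_of_le_of_ne hx0 (Ne.symm hxne))).ne' hx
  obtain ⟨B, hB⟩ := bddAbove_sq_sub_rpow (X := 1 / 2 * normSqA α A u) (by positivity) hc0 hθ
  refine ⟨max B (1 / 2 * normSqA α A u), ?_⟩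
  rintro _ ⟨t, ht, rfl⟩
  have ht0 : 0 ≤ t := ht
  simp only
  rw [energy_const_mul hu hu0 ht0]
  -- Superquadratic growth of `F` controls `t ≥ 1`; on `[0, 1]` positivity of `F` suffices.
  rcases le_total 1 t with h | h
  · refine le_max_of_le_left (le_trans ?_ (hB t h))
    have : t ^ θ * c ≤ ∫ x, primitive f (t * u x) := by
      rw [hc, ← integral_const_mul]
      refine integral_mono_ae (hi.const_mul _) (hint1 t ht0) ?_
      filter_upwards [hu0] with x hx
      rcases hx.eq_or_lt with h0 | h0
      · have : u x = 0 := h0.symm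
        simp [this, primitive]
      · exact rpow_mul_primitive_le hf hθ' h0 h
    linarith
  · refine le_max_of_le_right ?_
    have h1 : 0 ≤ ∫ x, primitive f (t * u x) := by
      refine integral_nonneg_of_ae ?_
      filter_upwards [hu0] with x hx using hF0 _ (mul_nonneg ht0 hx)
    have h2 : t ^ 2 * normSqA α A u ≤ 1 * normSqA α A u := by
      gcongr
      nlinarith
    linarith

theorem isWeakGradient_gradient {u : E N → ℝ} (hu : ContDiff ℝ ∞ u) :
    IsWeakGradient u (gradient u) := by
  have hgc := continuous_gradient hu
  refine ⟨hu.continuous.locallyIntegrable, hgc.locallyIntegrable, fun φ hφ hc i => ?_⟩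
  have hcont : ∀ {ψ : E N → ℝ}, ContDiff ℝ ∞ ψ →
      Continuous fun x => fderiv ℝ ψ x (EuclideanSpace.single i 1) := fun hψ =>
    (hψ.continuous_fderiv (by simp)).clm_apply continuous_const
  simp only [gradient_apply]
  refine integral_mul_fderiv_eq_neg_fderiv_mul_of_integrable ?_ ?_ ?_
    (fun x _ => hu.differentiable (by simp) x) (fun x _ => hφ.differentiable (by simp) x)
  · exact ((hcont hu).mul hφ.continuous).integrable_of_hasCompactSupport hc.mul_left
  · exact (hu.continuous.mul (hcont hφ)).integrable_of_hasCompactSupport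
      (hc.fderiv_apply (𝕜 := ℝ) _).mul_left
  · exact (hu.continuous.mul hφ.continuous).integrable_of_hasCompactSupport hc.mul_left

theorem exists_annular_bump (hN : 1 ≤ N) : ∃ u : E N → ℝ, ContDiff ℝ ∞ u ∧ (∀ x, 0 ≤ u x) ∧
    HasCompactSupport u ∧ (∀ x, u x ≠ 0 → 1 ≤ ‖x‖) ∧ (∀ x y, ‖x‖ = ‖y‖ → u x = u y) ∧ u ≠ 0 := by
  have : NeZero N := ⟨by omega⟩
  let b : ContDiffBump (3 : ℝ) := ⟨1, 2, by norm_num, by norm_num⟩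
  have hsupp : ∀ x : E N, b (‖x‖ ^ 2) ≠ 0 → 1 < ‖x‖ ^ 2 ∧ ‖x‖ ^ 2 < 5 := by
    intro x hx
    by_contra h
    apply hx
    apply b.zero_of_le_dist
    change 2 ≤ dist (‖x‖ ^ 2) 3
    rw [Real.dist_eq, le_abs]
    by_contra! h2
    exact h ⟨by linarith, by linarith⟩
  refine ⟨fun x => b (‖x‖ ^ 2), b.contDiff.comp (contDiff_norm_sq ℝ), fun x => b.nonneg,
    hasCompactSupport_of_support_subset (ε := 3) fun x hx => ?_, fun x hx => ?_,
    fun x y h => by simp only [h], fun h => ?_⟩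
  · rw [mem_closedBall_zero_iff]
    have := (hsupp x hx).2
    nlinarith [norm_nonneg x]
  · have := (hsupp x hx).1
    nlinarith [norm_nonneg x]
  · have h1 := congrFun h (EuclideanSpace.single 0 (Real.sqrt 3))
    have h2 : b (‖(EuclideanSpace.single 0 (Real.sqrt 3) : E N)‖ ^ 2) = 1 := by
      apply b.one_of_mem_closedBall
      simp [b]
    rw [h2] at h1
    exact one_ne_zero h1

theorem exists_memHr (hN : 1 ≤ N) {α : ℝ} (hα : 0 < α) :
    ∃ u : E N → ℝ, MemHr α u ∧ ¬ u =ᵐ[volume] 0 ∧ 0 ≤ᵐ[volume] u := by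
  obtain ⟨u, hs, h0, hcs, hsupp, hrad, hne⟩ := exists_annular_bump hN
  have hgc := continuous_gradient hs
  have hgs : HasCompactSupport (gradient u) :=
    (hcs.fderiv (𝕜 := ℝ)).comp_left (map_zero _)
  refine ⟨u, ⟨⟨⟨hs.continuous.memLp_of_hasCompactSupport hcs, gradient u,
    isWeakGradient_gradient hs, hgc.memLp_of_hasCompactSupport hgs⟩, ?_⟩,
    fun S => ae_of_all _ fun x => hrad _ _ (S.norm_map x)⟩,
    fun h => hne ((hs.continuous.ae_eq_iff_eq volume continuous_zero).1 h), ae_of_all _ h0⟩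
  have hi : Integrable (fun x => u x * u x) volume :=
    (hs.continuous.mul hs.continuous).integrable_of_hasCompactSupport hcs.mul_left
  have hm : Measurable fun x => u x ^ 2 / ‖x‖ ^ α :=
    (hs.continuous.measurable.pow_const 2).div (measurable_norm.pow_const α)
  refine hi.mono' hm.aestronglyMeasurable (ae_of_all _ fun x => ?_)
  rw [Real.norm_of_nonneg (by positivity), ← sq]
  by_cases hx : u x = 0
  · simp [hx]
  · exact div_le_self (sq_nonneg _) (Real.one_le_rpow (hsupp x hx) hα.le)

/-- The exponent `p` lies in `[p₁, p₂]` and between `2^*` and `2^*_α`, on whichever side of `2^*`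
the exponent `2^*_α` falls. -/
theorem interpolation_parameter (hN : 3 ≤ N) {α : ℝ} (hα1 : α < 2 * (N : ℝ) - 2) (hα2 : α ≠ 2)
    {p₁ p₂ p : ℝ} (hp₁' : p₁ < twoStar N) (hp₂ : twoStar N < p₂)
    (hp : p = if α < 2 then max (twoStarAlpha N α) p₁ else min (twoStarAlpha N α) p₂) :
    p₁ ≤ p ∧ p ≤ p₂ ∧ 0 ≤ (p - twoStar N) / (twoStarAlpha N α - twoStar N) ∧
      (p - twoStar N) / (twoStarAlpha N α - twoStar N) ≤ 1 ∧
      twoStarAlpha N α - twoStar N ≠ 0 := by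
  have hNr : (3 : ℝ) ≤ N := by exact_mod_cast hN
  have hd := twoStarAlpha_sub_twoStar hN hα1
  have hden : 0 < (2 * (N : ℝ) - 2 - α) * ((N : ℝ) - 2) := mul_pos (by linarith) (by linarith)
  rcases lt_or_gt_of_ne hα2 with h | h
  · rw [if_pos h] at hp
    have hneg : twoStarAlpha N α - twoStar N < 0 := by
      rw [hd]
      exact div_neg_of_neg_of_pos (mul_neg_of_pos_of_neg (by linarith) (by linarith)) hden
    have h1 : p ≤ twoStar N := by rw [hp]; exact max_le (by linarith) hp₁'.le
    have h2 : twoStarAlpha N α ≤ p := by rw [hp]; exact le_max_left _ _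
    refine ⟨by rw [hp]; exact le_max_right _ _, by linarith,
      div_nonneg_of_nonpos (by linarith) hneg.le, ?_, hneg.ne⟩
    rw [div_le_one_of_neg hneg]
    linarith
  · rw [if_neg (not_lt.2 h.le)] at hp
    have hpos : 0 < twoStarAlpha N α - twoStar N := by
      rw [hd]
      exact div_pos (mul_pos (by linarith) (by linarith)) hden
    have h1 : twoStar N ≤ p := by rw [hp]; exact le_min (by linarith) hp₂.le
    have h2 : p ≤ twoStarAlpha N α := by rw [hp]; exact min_le_left _ _
    refine ⟨by linarith, by rw [hp]; exact min_le_right _ _,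
      div_nonneg (by linarith) hpos.le, ?_, hpos.ne'⟩
    rw [div_le_one hpos]
    linarith

theorem integrable_rpow_of_lintegral {u : E N → ℝ} (hu : AEStronglyMeasurable u volume) {p : ℝ}
    (hp : 0 ≤ p) {B : ℝ} (hB : 0 ≤ B) (h : ∫⁻ x, ‖u x‖ₑ ^ p ≤ ENNReal.ofReal B) :
    Integrable (fun x => ‖u x‖ ^ p) volume ∧ ∫ x, ‖u x‖ ^ p ≤ B := by
  have hm : AEStronglyMeasurable (fun x => ‖u x‖ ^ p) volume :=
    (Real.continuous_rpow_const hp).comp_aestronglyMeasurable hu.norm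
  have he : ∫⁻ x, ENNReal.ofReal (‖u x‖ ^ p) = ∫⁻ x, ‖u x‖ₑ ^ p :=
    lintegral_congr fun x => by
      rw [← ofReal_norm, ENNReal.ofReal_rpow_of_nonneg (norm_nonneg _) hp]
  constructor
  · refine ⟨hm, ?_⟩
    rw [hasFiniteIntegral_iff_ofReal (ae_of_all _ fun x => by positivity), he]
    exact h.trans_lt ENNReal.ofReal_lt_top
  · rw [integral_eq_lintegral_of_nonneg_ae (ae_of_all _ fun x => by positivity) hm, he]
    exact ENNReal.toReal_le_of_le_ofReal hB h

end RadialNehari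

theorem proposition3p2
    (N : ℕ) (hN : 3 ≤ N)
    (α : ℝ) (hα0 : 0 < α) (hα1 : α < 2 * (N : ℝ) - 2) (hα2 : α ≠ 2)
    (p₁ p₂ : ℝ) (hp₁ : 2 < p₁) (hp₁' : p₁ < twoStar N) (hp₂ : twoStar N < p₂)
    (f : ℝ → ℝ) (hf : Continuous f)
    (hfp : BddAbove ((fun s : ℝ => |f s| / min (s ^ (p₁ - 1)) (s ^ (p₂ - 1))) '' Set.Ioi 0))
    (hf1 : ∃ θ : ℝ, 2 < θ ∧ ∀ s : ℝ, 0 < s → θ * primitive f s ≤ f s * s)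
    (hf2 : ∀ s : ℝ, 0 < s → 0 < primitive f s)
    (p : ℝ)
    (hp : p = if α < 2 then max (twoStarAlpha N α) p₁ else min (twoStarAlpha N α) p₂) :
    ∃ C₀ : ℝ, 0 < C₀ ∧ ∀ A : ℝ, 0 < A →
      C₀ * A ^ (((N : ℝ) - 2) / (α - 2) * ((p - twoStar N) / (p - 2)))
        ≤ nehariLevel N α A f := by
  have hNr : (3 : ℝ) ≤ N := by exact_mod_cast hN
  obtain ⟨h1, h2, ht0, ht1, hd⟩ := interpolation_parameter hN hα1 hα2 hp₁' hp₂ hp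
  set t := (p - twoStar N) / (twoStarAlpha N α - twoStar N) with ht
  have hpt : p = t * twoStarAlpha N α + (1 - t) * twoStar N := by
    have : t * (twoStarAlpha N α - twoStar N) = p - twoStar N := div_mul_cancel₀ _ hd
    linarith
  have hp2 : 2 < p := by linarith
  obtain ⟨M, hM0, hM⟩ := exists_abs_primitive_le hfp (by linarith : 1 < p) h1 h2
  obtain ⟨K, hK0, hK⟩ := exists_embedding_between hN hα0 hα1 ht0 ht1 hpt
  set μ := t * ((2 * (N : ℝ) - 2) / (2 * (N : ℝ) - 2 - α)) with hμ
  have hexp : ((N : ℝ) - 2) / (α - 2) * ((p - twoStar N) / (p - 2)) = 2 * μ / (p - 2) := by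
    rw [hμ, ht, twoStarAlpha_sub_twoStar hN hα1]
    have e1 : (N : ℝ) - 2 ≠ 0 := by linarith
    have e2 : p - 2 ≠ 0 := by linarith
    have e3 : α - 2 ≠ 0 := sub_ne_zero.2 hα2
    have e4 : 2 * (N : ℝ) - 2 - α ≠ 0 := by linarith
    have e5 : (N : ℝ) - 1 ≠ 0 := by linarith
    rw [show 2 * (N : ℝ) - 2 = 2 * ((N : ℝ) - 1) by ring] at e4 ⊢
    field_simp
    ring
  refine ⟨1 / 4 * (4 * M * K) ^ (-(2 / (p - 2))), by positivity, fun A hA => ?_⟩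
  obtain ⟨u₀, hu₀⟩ := exists_memHr (N := N) (by omega) hα0
  -- Without an admissible function the infimum would be the junk value `0`.
  refine le_csInf ⟨_, Set.mem_image_of_mem _ hu₀⟩ ?_
  rintro _ ⟨u, ⟨hu, hne, hu0⟩, rfl⟩
  have hX := normSqA_pos (by omega) hA hu.1 hne
  have hint := hK A hA u hu hX
  set X := normSqA α A u with hXdef
  obtain ⟨hup, hle⟩ := integrable_rpow_of_lintegral hu.1.1.1.1 (by linarith) (by positivity) hint
  have hbdd := bddAbove_energy (A := A) hf hf1 hf2 hu.1 hu0 hne hM hup hX.le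
  -- `s = τ ‖u‖_A` is chosen so that the superquadratic term `M K A^{-μ} s^p` equals `s² / 4`,
  -- that is, half of the quadratic term.
  set κ : ℝ := 4 * M * K * A ^ (-μ) with hκ
  have hκ0 : 0 < κ := by positivity
  set s : ℝ := κ ^ (-(1 / (p - 2))) with hs
  have hs0 : 0 < s := by positivity
  have hsp : s ^ (p - 2) = κ⁻¹ := by
    rw [hs, ← Real.rpow_mul hκ0.le, neg_mul, one_div_mul_cancel (by linarith), Real.rpow_neg_one]
  set τ : ℝ := s * X ^ (-(1 / 2) : ℝ) with hτ
  have hτ0 : 0 ≤ τ := by positivity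
  refine le_trans ?_ (le_csSup hbdd (Set.mem_image_of_mem _ (Set.mem_Ici.2 hτ0)))
  rw [energy_const_mul hu.1 hu0 hτ0, ← hXdef]
  have hF := integral_primitive_le hf hu.1.1.1.1 hu0 hM hup hτ0
  have e1 : τ ^ 2 * X = s ^ 2 := by
    rw [hτ, mul_pow, ← Real.rpow_natCast (X ^ _), ← Real.rpow_mul hX.le, mul_assoc]
    norm_num
    rw [Real.rpow_neg_one, inv_mul_cancel₀ hX.ne', mul_one]
  have e2 : τ ^ p * X ^ (p / 2) = s ^ p := by
    rw [hτ, Real.mul_rpow hs0.le (by positivity), ← Real.rpow_mul hX.le, mul_assoc,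
      ← Real.rpow_add hX, show -(1 / 2) * p + p / 2 = 0 by ring, Real.rpow_zero, mul_one]
  have e3 : s ^ p = s ^ 2 * κ⁻¹ := by
    rw [← hsp, ← Real.rpow_two, ← Real.rpow_add hs0]
    congr 1; ring
  have e4 : M * τ ^ p * (K * A ^ (-μ) * X ^ (p / 2)) = s ^ 2 / 4 := by
    calc M * τ ^ p * (K * A ^ (-μ) * X ^ (p / 2))
        = κ / 4 * (τ ^ p * X ^ (p / 2)) := by rw [hκ]; ring
      _ = s ^ 2 / 4 := by
        rw [e2, e3]
        field_simp
  have e5 : s ^ 2 = (4 * M * K) ^ (-(2 / (p - 2))) * A ^ (2 * μ / (p - 2)) := by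
    rw [hs, ← Real.rpow_natCast, ← Real.rpow_mul hκ0.le, hκ, Real.mul_rpow (by positivity)
      (by positivity), ← Real.rpow_mul hA.le]
    congr 2
    · push_cast; ring
    · push_cast; ring
  have h3 : M * τ ^ p * ∫ x, ‖u x‖ ^ p ≤ s ^ 2 / 4 := by
    rw [← e4]
    gcongr
  rw [hexp, e1, mul_assoc, ← e5]
  linarith
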